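/- Let $d\ge 1$, $n\ge 0$ be integers. Let $G$ be $SO(d)$ or $O(d)$, acting on $\mathbb{R}^{d\times n}$ by left multiplication. For $X\in\mathbb{R}^{d\times n}$ with columns $x_1,\dots,x_n$ put $r(X)=\min(\operatorname{rank}X,\,d-1)$ if $G=SO(d)$, and $r(X)=\operatorname{rank}X$ if $G=O(d)$. **Weights.** Let $\Delta(v_1,\dots,v_t)=\sqrt{|\det(\langle v_a,v_b\rangle)_{a,b\le t}|}$ be the volume of the parallelotope spanned by $v_1,\dots,v_t$. For indices $i_1,\dots,i_t\in\{1,\dots,n\}$ let $$w_{i_1\cdots i_t}(X)=\frac{\Delta(x_{i_1},\dots,x_{i_t})}{\sum_{j=1}^n\Delta(x_{i_1},\dots,x_{i_{t-1}},x_j)}$$ if $x_{i_1},\dots,x_{i_{t-1}}$ are linearly independent, and $w_{i_1\cdots i_t}(X)=1/n$ otherwise. **Group elements.** A *Gram–Schmidt choice* assigns to every $X$ and every sequence $i_1,\dots,i_r$ of $r=r(X)$ indices an element $g_{i_1\cdots i_r}(X)\in G$ such that the $d\times r$ matrix $A=g_{i_1\cdots i_r}(X)^{-1}(x_{i_1},\dots,x_{i_r})$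 is upper triangular with non-negative diagonal entries and satisfies $A^TA=(\langle x_{i_a},x_{i_b}\rangle)_{a,b}$. **Frame.** Given a Gram–Schmidt choice and a Borel probability measure $\nu$ on $G$, put $\mu_0=\nu$ and, for $X\neq 0$ and $r=r(X)$, $$\mu_X=\sum_{i_1=1}^n w_{i_1}(X)\sum_{i_2=1}^n w_{i_1i_2}(X)\cdots\sum_{i_r=1}^n w_{i_1\cdots i_r}(X)\,\delta_{g_{i_1\cdots i_r}(X)} .$$ **Notions.** A weighted frame is a map $X\mapsto\mu_X$ from $\mathbb{R}^{d\times n}$ to the Borel probability measures on $G$. Let $G_X$ be the stabilizer of $X$, with Haar probability measure $ds$. For a Borel probability measure $\tau$ on $G$ let $\langle\tau\rangle_X(B)=\int_{G_X}(s_*\tau)(B)\,ds$. A weighted frame is *weakly equivariant* if $\langle\mu_{gX}\rangle_{gX}=g_*\langle\mu_X\rangle_X$ for all $g\in G$ and all $X$; it is *continuous* if $X_k\to X$ implies $\langle\mu_{X_k}\rangle_X\to\langle\mu_X\rangle_X$ weakly; it is *robust* if it is both. Its *cardinality* is $\sup_X|\{g\in G:\mu_X(\{g\})>0\}|$. **Proposition.**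 Let $N=n(n-1)\cdots(n-d+2)$ (with $N=1$ if $d=1$). 1. ($G=SO(d)$.) Gram–Schmidt choices exist. For every Gram–Schmidt choice and every $\nu$, $\mu$ is a well-defined weighted frame (every $\mu_X$ is a probability measure), and it is robust. If $n\ge d-1$ and $\nu$ has at most $N$ atoms, then $\mu$ has cardinality exactly $N$. 2. ($G=O(d)$.) Gram–Schmidt choices exist. For every Gram–Schmidt choice and every $\nu$, $\mu$ is a well-defined weighted frame, and it is robust. If $n\ge d-1$ and $\nu$ has at most $2N$ atoms, then $\mu$ has cardinality at most $2N$, with equality if $n\ge d+1$. -/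

import Mathlib

open MeasureTheory Filter Topology
open scoped ENNReal

/-! ### Weighted frames for a compact group acting on a space -/

section WeightedFrames

variable {G V : Type*} [Group G] [TopologicalSpace G] [IsTopologicalGroup G] [CompactSpace G]
  [TopologicalSpace V] [T2Space V] [MulAction G V] [ContinuousSMul G V]

instance stabilizerCompactSpace (v : V) : CompactSpace (MulAction.stabilizer G v) := by
  have h : IsClosed {g : G | g • v = v} :=
    isClosed_eq (continuous_id.smul continuous_const) continuous_const
  exact isCompact_iff_compactSpace.mp h.isCompact

variable [SecondCountableTopology G] [MeasurableSpace G] [BorelSpace G]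

/-- The Haar probability measure of the stabilizer `G_v`. -/
noncomputable def stabilizerHaar (v : V) : Measure (MulAction.stabilizer G v) :=
  Measure.haarMeasure ⊤

instance stabilizerHaar_isProbabilityMeasure (v : V) :
    IsProbabilityMeasure (stabilizerHaar (G := G) v) :=
  ⟨Measure.haarMeasure_self (K₀ := (⊤ : TopologicalSpace.PositiveCompacts _))⟩

instance stabilizerHaar_map_isProbabilityMeasure (v : V) :
    IsProbabilityMeasure ((stabilizerHaar (G := G) v).map Subtype.val) :=
  Measure.isProbabilityMeasure_map measurable_subtype_coe.aemeasurable

/-- The average `⟨τ⟩_v` of a probability measure `τ` on `G` over the stabilizer of `v`: the law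
of the product `s * g`, where `s` is Haar distributed on `G_v` and `g` is independent of `s` with
law `τ`. See `stabilizerAverage_apply` for the integral formula. -/
noncomputable def stabilizerAverage (v : V) (τ : ProbabilityMeasure G) : ProbabilityMeasure G :=
  ⟨((stabilizerHaar (G := G) v).map Subtype.val).mconv (τ : Measure G), inferInstance⟩

/-- `⟨τ⟩_v (A) = ∫_{G_v} (s_* τ)(A) ds`. -/
theorem stabilizerAverage_apply (v : V) (τ : ProbabilityMeasure G) {A : Set G}
    (hA : MeasurableSet A) :
    (stabilizerAverage v τ : Measure G) A =
      ∫⁻ s : MulAction.stabilizer G v,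
        ((τ : Measure G).map fun g => (s : G) * g) A ∂(stabilizerHaar v) := by
  have h1 : (stabilizerAverage v τ : Measure G) A =
      ∫⁻ z, A.indicator 1 z ∂(((stabilizerHaar (G := G) v).map Subtype.val).mconv
        (τ : Measure G)) := by
    rw [lintegral_indicator_one hA]; rfl
  have hm : Measurable (A.indicator (1 : G → ℝ≥0∞)) := measurable_one.indicator hA
  rw [h1, Measure.lintegral_mconv hm, lintegral_map _ measurable_subtype_coe]
  · refine lintegral_congr fun s => ?_
    rw [← lintegral_indicator_one hA, lintegral_map hm (measurable_const_mul _)]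
  · exact Measurable.lintegral_prod_right' (f := fun p : G × G => A.indicator 1 (p.1 * p.2))
      (hm.comp measurable_mul)

/-- A weighted frame `v ↦ μ v` is weakly equivariant if
`⟨μ (g v)⟩_{g v} = g_* ⟨μ v⟩_v` for all `g` and `v`. -/
def IsWeaklyEquivariant (μ : V → ProbabilityMeasure G) : Prop :=
  ∀ (v : V) (g : G),
    (stabilizerAverage (g • v) (μ (g • v)) : Measure G) =
      (stabilizerAverage v (μ v) : Measure G).map fun h => g * h

/-- A weighted frame is continuous if `⟨μ (v_k)⟩_v → ⟨μ v⟩_v` weakly whenever `v_k → v`. -/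
def IsContinuousFrame (μ : V → ProbabilityMeasure G) : Prop :=
  ∀ (v : V) (u : ℕ → V), Tendsto u atTop (𝓝 v) →
    Tendsto (fun k => stabilizerAverage v (μ (u k))) atTop (𝓝 (stabilizerAverage v (μ v)))

/-- A robust frame is a continuous, weakly equivariant, weighted frame. -/
def IsRobustFrame (μ : V → ProbabilityMeasure G) : Prop :=
  IsWeaklyEquivariant μ ∧ IsContinuousFrame μ

end WeightedFrames

/-- The number of atoms of `τ`, i.e. of `g` with `τ {g} > 0`. -/
noncomputable def atomCount {G : Type*} [MeasurableSpace G] (τ : ProbabilityMeasure G) : ℕ∞ :=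
  {g : G | 0 < (τ : Measure G) {g}}.encard

/-- The cardinality of a weighted frame. -/
noncomputable def frameCardinality {G V : Type*} [MeasurableSpace G]
    (μ : V → ProbabilityMeasure G) : ℕ∞ :=
  ⨆ v : V, atomCount (μ v)

/-! ### The groups `SO(d)` and `O(d)` acting on `ℝ^{d × n}` -/

/-- The rotation group `SO(d)`. -/
abbrev SOGroup (d : ℕ) : Type := Matrix.specialOrthogonalGroup (Fin d) ℝ

/-- The orthogonal group `O(d)`. -/
abbrev OGroup (d : ℕ) : Type := Matrix.orthogonalGroup (Fin d) ℝ

/-- A matrix group acts on point clouds (the columns of `X`) by left multiplication. -/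
instance pointCloudMulAction {d n : ℕ} (S : Submonoid (Matrix (Fin d) (Fin d) ℝ)) :
    MulAction S (Matrix (Fin d) (Fin n) ℝ) where
  smul g X := (g : Matrix (Fin d) (Fin d) ℝ) * X
  one_smul X := Matrix.one_mul X
  mul_smul g h X := Matrix.mul_assoc (g : Matrix (Fin d) (Fin d) ℝ) h X

instance pointCloudContinuousSMul {d n : ℕ} (S : Submonoid (Matrix (Fin d) (Fin d) ℝ)) :
    ContinuousSMul S (Matrix (Fin d) (Fin n) ℝ) where
  continuous_smul :=
    (continuous_subtype_val.comp continuous_fst).matrix_mul continuous_snd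

instance orthogonalIsTopologicalGroup (d : ℕ) : IsTopologicalGroup (OGroup d) :=
  inferInstanceAs (IsTopologicalGroup (unitary (Matrix (Fin d) (Fin d) ℝ)))

instance rotationIsTopologicalGroup (d : ℕ) : IsTopologicalGroup (SOGroup d) where
  continuous_inv := by
    refine continuous_induced_rng.mpr ?_
    exact (continuous_subtype_val (p := fun A : Matrix (Fin d) (Fin d) ℝ =>
      A ∈ Matrix.specialOrthogonalGroup (Fin d) ℝ)).star

theorem isCompact_orthogonal (d : ℕ) :
    IsCompact (Matrix.orthogonalGroup (Fin d) ℝ : Set (Matrix (Fin d) (Fin d) ℝ)) := by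
  refine IsCompact.of_isClosed_subset
    (isCompact_univ_pi fun _ : Fin d => isCompact_univ_pi fun _ : Fin d =>
      isCompact_closedBall (0 : ℝ) 1) isClosed_unitary ?_
  intro U hU a _ b _
  rw [mem_closedBall_zero_iff]
  exact entry_norm_bound_of_unitary hU a b

instance orthogonalCompactSpace (d : ℕ) : CompactSpace (OGroup d) :=
  isCompact_iff_compactSpace.mp (isCompact_orthogonal d)

instance rotationCompactSpace (d : ℕ) : CompactSpace (SOGroup d) := by
  have h : (Matrix.specialOrthogonalGroup (Fin d) ℝ : Set (Matrix (Fin d) (Fin d) ℝ)) =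
      (Matrix.orthogonalGroup (Fin d) ℝ : Set (Matrix (Fin d) (Fin d) ℝ)) ∩ {A | A.det = 1} := by
    ext A
    exact Matrix.mem_specialOrthogonalGroup_iff
  refine isCompact_iff_compactSpace.mp ?_
  rw [h]
  exact (isCompact_orthogonal d).inter_right
    (isClosed_eq continuous_id.matrix_det continuous_const)

instance matrixSecondCountable (d : ℕ) : SecondCountableTopology (Matrix (Fin d) (Fin d) ℝ) :=
  inferInstanceAs (SecondCountableTopology (Fin d → Fin d → ℝ))

instance matrixGroupSecondCountable {d : ℕ} (S : Submonoid (Matrix (Fin d) (Fin d) ℝ)) :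
    SecondCountableTopology S :=
  TopologicalSpace.Subtype.secondCountableTopology (S : Set (Matrix (Fin d) (Fin d) ℝ))

/-- Matrix groups carry their Borel sigma-algebra. -/
instance matrixGroupMeasurableSpace {d : ℕ} (S : Submonoid (Matrix (Fin d) (Fin d) ℝ)) :
    MeasurableSpace S := borel S

instance matrixGroupBorelSpace {d : ℕ} (S : Submonoid (Matrix (Fin d) (Fin d) ℝ)) :
    BorelSpace S := ⟨rfl⟩

/-! ### The Gram-Schmidt frames -/

section GramSchmidtFrames

variable {d n : ℕ}

/-- The Gram matrix of the sequence of columns `x_{i 0}, x_{i 1}, …` of `X`. -/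
def columnGram (X : Matrix (Fin d) (Fin n) ℝ) {t : ℕ} (i : Fin t → Fin n) :
    Matrix (Fin t) (Fin t) ℝ :=
  Matrix.of fun a b => X.col (i a) ⬝ᵥ X.col (i b)

/-- The volume `Δ(x_{i 0}, …, x_{i (t-1)})` of the parallelotope spanned by a sequence of
columns of `X`. -/
noncomputable def columnVolume (X : Matrix (Fin d) (Fin n) ℝ) {t : ℕ} (i : Fin t → Fin n) : ℝ :=
  √|(columnGram X i).det|

open Classical in
/-- The weight of the index `j` after the index sequence `i`: proportional to the volume of the
columns `i` followed by the column `j` if the columns `i` are linearly independent, and `1 / n`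
otherwise. -/
noncomputable def columnWeight (X : Matrix (Fin d) (Fin n) ℝ) {t : ℕ} (i : Fin t → Fin n)
    (j : Fin n) : ℝ :=
  if LinearIndependent ℝ (fun a : Fin t => X.col (i a)) then
    columnVolume X (Fin.snoc i j : Fin (t + 1) → Fin n) /
      ∑ k : Fin n, columnVolume X (Fin.snoc i k : Fin (t + 1) → Fin n)
  else 1 / (n : ℝ)

/-- The total weight `w_{i_1} w_{i_1 i_2} ⋯ w_{i_1 ⋯ i_r}` of the index sequence `i`. -/
noncomputable def totalWeight (X : Matrix (Fin d) (Fin n) ℝ) {r : ℕ} (i : Fin r → Fin n) : ℝ :=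
  ∏ t : Fin r, columnWeight X (fun a : Fin t => i (Fin.castLE t.isLt.le a)) (i t)

/-- `g⁻¹` brings the columns `x_{i_1}, …, x_{i_r}` of `X` into the upper triangular form `A`,
with non-negative diagonal entries and with the same Gram matrix. -/
def IsGramSchmidtTransform (g : Matrix (Fin d) (Fin d) ℝ) (X : Matrix (Fin d) (Fin n) ℝ) {r : ℕ}
    (i : Fin r → Fin n) : Prop :=
  ∃ A : Matrix (Fin d) (Fin r) ℝ,
    (∀ (a : Fin d) (b : Fin r), (b : ℕ) < (a : ℕ) → A a b = 0) ∧
    (∀ (a : Fin d) (b : Fin r), (a : ℕ) = (b : ℕ) → 0 ≤ A a b) ∧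
    A.transpose * A = columnGram X i ∧
    g⁻¹ * X.submatrix id i = A

/-- A choice, for every `X` and every sequence `i` of `r X` column indices, of an element
`γ X i` of the matrix group `S` that brings these columns into upper triangular form. -/
def IsGramSchmidtChoice (S : Submonoid (Matrix (Fin d) (Fin d) ℝ))
    (r : Matrix (Fin d) (Fin n) ℝ → ℕ)
    (γ : (X : Matrix (Fin d) (Fin n) ℝ) → (Fin (r X) → Fin n) → S) : Prop :=
  ∀ X i, IsGramSchmidtTransform (γ X i : Matrix (Fin d) (Fin d) ℝ) X i

/-- `μ` is the weighted frame built from the choice `γ`: it is `∑ i, W_i(X) δ_{γ X i}` at every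
`X ≠ 0`, the sum being over all sequences of `r X` column indices, and it is the prescribed
measure `ν` at `X = 0`. -/
def IsGramSchmidtFrame (S : Submonoid (Matrix (Fin d) (Fin d) ℝ))
    (r : Matrix (Fin d) (Fin n) ℝ → ℕ)
    (γ : (X : Matrix (Fin d) (Fin n) ℝ) → (Fin (r X) → Fin n) → S)
    (ν : ProbabilityMeasure S) (μ : Matrix (Fin d) (Fin n) ℝ → ProbabilityMeasure S) : Prop :=
  μ 0 = ν ∧
  ∀ X, X ≠ 0 → (μ X : Measure S) =
    ∑ i : Fin (r X) → Fin n, ENNReal.ofReal (totalWeight X i) • Measure.dirac (γ X i)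

/-- The length of the index sequences for `SO(d)`. -/
noncomputable def rotationLength (X : Matrix (Fin d) (Fin n) ℝ) : ℕ := min X.rank (d - 1)

/-- The length of the index sequences for `O(d)`. -/
noncomputable def orthogonalLength (X : Matrix (Fin d) (Fin n) ℝ) : ℕ := X.rank

end GramSchmidtFrames

/-! The weights see `X` only through Gram matrices, hence are invariant under orthogonal matrices.
As long as the length does not exceed the rank, summing out the last index turns the total weight of
a sequence into that of the shorter sequence (`sum_totalWeight_castLE`); in particular the total
weights sum to one. A sequence has nonzero total weight exactly when its columns are independent, so
whatever is chosen at dependent sequences never counts.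

At an independent sequence the triangular form is a Cholesky factor of the Gram matrix, hence
unique. Two Gram-Schmidt transforms therefore differ by left multiplication by an element fixing the
selected columns. Such an element fixes all of `X`: if `r` is the rank, the selected columns span
the column space; if `r = d - 1` and the group is `SO(d)`, the element is the identity. Averaging
over the stabilizer thus erases the choice (`IsAdmissibleLength.eq_of_invariant`). Weak equivariance
follows, because multiplying a transform for `X` by `g` gives a transform for `g • X`.

For continuity, the rank can only grow near `X`. For `Y` near `X`, cut the index sequences of `Y`
down to length `r X`: the weights of the cut sequences are marginals, and a transform for a sequence
is also one for its initial segments. If the cut sequence is independent at `X`, then closedness of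
the Gram-Schmidt condition and compactness of `G` bring the transform at `Y` close to the one at
`X`, modulo the stabilizer. If it is dependent at `X`, its weight tends to zero. At `X = 0` the
stabilizer is all of `G`, so every average is Haar measure.

The atoms at `X ≠ 0` are the transforms of independent sequences. For `SO(d)` there are at most as
many as injective sequences of length at most `d - 1`; for `O(d)` a long sequence enters only
through its first `d - 1` indices and the sign of a determinant. The bounds are attained on a moment
curve, whose points are in general position. For `O(d)` its points are rescaled to sum to zero, so
that every `d - 1` of them extend to bases of both orientations. -/

section LinearAlgebra

variable {d n : ℕ}

/-! ### Gram matrices and independence of columns. -/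

theorem columnGram_eq_transpose_mul (X : Matrix (Fin d) (Fin n) ℝ) {t : ℕ} (i : Fin t → Fin n) :
    columnGram X i = (X.submatrix id i).transpose * X.submatrix id i := by
  ext a b
  simp [columnGram, Matrix.mul_apply, dotProduct, Matrix.col]

theorem col_submatrix_id (X : Matrix (Fin d) (Fin n) ℝ) {t : ℕ} (i : Fin t → Fin n) :
    (X.submatrix id i).col = fun a => X.col (i a) := rfl

theorem transpose_mul_self_of_mem_orthogonal {g : Matrix (Fin d) (Fin d) ℝ}
    (hg : g ∈ Matrix.orthogonalGroup (Fin d) ℝ) : g.transpose * g = 1 :=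
  (Matrix.mem_orthogonalGroup_iff' _ _).mp hg

theorem mul_transpose_self_of_mem_orthogonal {g : Matrix (Fin d) (Fin d) ℝ}
    (hg : g ∈ Matrix.orthogonalGroup (Fin d) ℝ) : g * g.transpose = 1 :=
  (Matrix.mem_orthogonalGroup_iff _ _).mp hg

theorem inv_eq_transpose_of_mem_orthogonal {g : Matrix (Fin d) (Fin d) ℝ}
    (hg : g ∈ Matrix.orthogonalGroup (Fin d) ℝ) : g⁻¹ = g.transpose :=
  Matrix.inv_eq_left_inv (transpose_mul_self_of_mem_orthogonal hg)

theorem transpose_mul_transpose_mul_of_mem_orthogonal {g : Matrix (Fin d) (Fin d) ℝ}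
    (hg : g ∈ Matrix.orthogonalGroup (Fin d) ℝ) {t : ℕ} (B : Matrix (Fin d) (Fin t) ℝ) :
    (g.transpose * B).transpose * (g.transpose * B) = B.transpose * B := by
  rw [Matrix.transpose_mul, Matrix.transpose_transpose, Matrix.mul_assoc, ← Matrix.mul_assoc g,
    mul_transpose_self_of_mem_orthogonal hg, Matrix.one_mul]

theorem columnGram_orthogonal_mul {g : Matrix (Fin d) (Fin d) ℝ}
    (hg : g ∈ Matrix.orthogonalGroup (Fin d) ℝ) (X : Matrix (Fin d) (Fin n) ℝ) {t : ℕ}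
    (i : Fin t → Fin n) : columnGram (g * X) i = columnGram X i := by
  have hsub : (g * X).submatrix id i = g * X.submatrix id i := rfl
  rw [columnGram_eq_transpose_mul, columnGram_eq_transpose_mul, hsub, Matrix.transpose_mul,
    Matrix.mul_assoc, ← Matrix.mul_assoc _ g, transpose_mul_self_of_mem_orthogonal hg,
    Matrix.one_mul]

theorem columnGram_det_ne_zero_iff (X : Matrix (Fin d) (Fin n) ℝ) {t : ℕ} (i : Fin t → Fin n) :
    (columnGram X i).det ≠ 0 ↔ LinearIndependent ℝ (fun a : Fin t => X.col (i a)) := by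
  rw [← col_submatrix_id, ← Matrix.mulVec_injective_iff, columnGram_eq_transpose_mul]
  constructor
  · intro h v w hvw
    have hinj : Function.Injective
        ((X.submatrix id i).transpose * X.submatrix id i).mulVec :=
      Matrix.mulVec_injective_iff_isUnit.mpr
        ((Matrix.isUnit_iff_isUnit_det _).mpr (isUnit_iff_ne_zero.mpr h))
    apply hinj
    rw [← Matrix.mulVec_mulVec, ← Matrix.mulVec_mulVec, hvw]
  · intro h
    have hpos := Matrix.PosDef.conjTranspose_mul_self _ h
    rw [Matrix.conjTranspose_eq_transpose_of_trivial] at hpos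
    exact hpos.det_pos.ne'

theorem columnVolume_nonneg (X : Matrix (Fin d) (Fin n) ℝ) {t : ℕ} (i : Fin t → Fin n) :
    0 ≤ columnVolume X i := Real.sqrt_nonneg _

theorem columnVolume_ne_zero_iff (X : Matrix (Fin d) (Fin n) ℝ) {t : ℕ} (i : Fin t → Fin n) :
    columnVolume X i ≠ 0 ↔ LinearIndependent ℝ (fun a : Fin t => X.col (i a)) := by
  rw [columnVolume, Real.sqrt_ne_zero (abs_nonneg _), abs_ne_zero, columnGram_det_ne_zero_iff]

theorem col_snoc (X : Matrix (Fin d) (Fin n) ℝ) {t : ℕ} (i : Fin t → Fin n) (k : Fin n) :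
    (fun a : Fin (t + 1) => X.col ((Fin.snoc i k : Fin (t + 1) → Fin n) a)) =
      (Fin.snoc (fun a : Fin t => X.col (i a)) (X.col k) : Fin (t + 1) → Fin d → ℝ) := by
  funext a
  refine Fin.lastCases ?_ (fun a => ?_) a <;> simp

theorem exists_linearIndependent_snoc (X : Matrix (Fin d) (Fin n) ℝ) {t : ℕ} (i : Fin t → Fin n)
    (hi : LinearIndependent ℝ (fun a : Fin t => X.col (i a))) (ht : t < X.rank) :
    ∃ k, LinearIndependent ℝ
      (fun a : Fin (t + 1) => X.col ((Fin.snoc i k : Fin (t + 1) → Fin n) a)) := by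
  by_contra! h
  have hmem : ∀ k, X.col k ∈ Submodule.span ℝ (Set.range fun a : Fin t => X.col (i a)) := by
    intro k
    have hk := h k
    rw [col_snoc, linearIndependent_finSnoc] at hk
    by_contra hn
    exact hk ⟨hi, hn⟩
  have hle : Submodule.span ℝ (Set.range X.col) ≤
      Submodule.span ℝ (Set.range fun a : Fin t => X.col (i a)) := by
    rw [Submodule.span_le]
    rintro _ ⟨k, rfl⟩
    exact hmem k
  have h1 := Submodule.finrank_mono hle
  rw [← Matrix.rank_eq_finrank_span_cols, finrank_span_eq_card hi, Fintype.card_fin] at h1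
  omega

theorem exists_linearIndependent_columns (X : Matrix (Fin d) (Fin n) ℝ) {t : ℕ}
    (ht : t ≤ X.rank) :
    ∃ i : Fin t → Fin n, LinearIndependent ℝ (fun a : Fin t => X.col (i a)) := by
  induction t with
  | zero => exact ⟨Fin.elim0, linearIndependent_empty_type⟩
  | succ t ih =>
    obtain ⟨i, hi⟩ := ih (by omega)
    obtain ⟨k, hk⟩ := exists_linearIndependent_snoc X i hi (by omega)
    exact ⟨_, hk⟩

theorem le_rank_of_linearIndependent_columns {X : Matrix (Fin d) (Fin n) ℝ} {t : ℕ}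
    {i : Fin t → Fin n} (hi : LinearIndependent ℝ (fun a : Fin t => X.col (i a))) :
    t ≤ X.rank := by
  have hle : Submodule.span ℝ (Set.range fun a : Fin t => X.col (i a)) ≤
      Submodule.span ℝ (Set.range X.col) := by
    refine Submodule.span_mono ?_
    rintro _ ⟨k, rfl⟩
    exact ⟨_, rfl⟩
  have h1 := Submodule.finrank_mono hle
  rwa [← Matrix.rank_eq_finrank_span_cols, finrank_span_eq_card hi, Fintype.card_fin] at h1

theorem continuous_columnGram_det {t : ℕ} (i : Fin t → Fin n) :
    Continuous fun X : Matrix (Fin d) (Fin n) ℝ => (columnGram X i).det := by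
  refine Continuous.matrix_det ?_
  simp_rw [columnGram_eq_transpose_mul]
  have h : Continuous fun X : Matrix (Fin d) (Fin n) ℝ => X.submatrix id i :=
    continuous_id.matrix_submatrix _ _
  exact h.matrix_transpose.matrix_mul h

theorem continuous_columnVolume {t : ℕ} (i : Fin t → Fin n) :
    Continuous fun X : Matrix (Fin d) (Fin n) ℝ => columnVolume X i :=
  (continuous_columnGram_det i).abs.sqrt

theorem eventually_linearIndependent_columns {X : Matrix (Fin d) (Fin n) ℝ} {t : ℕ}
    {i : Fin t → Fin n} (hi : LinearIndependent ℝ (fun a : Fin t => X.col (i a))) :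
    ∀ᶠ Y in 𝓝 X, LinearIndependent ℝ
      (fun a : Fin t => (Y : Matrix (Fin d) (Fin n) ℝ).col (i a)) := by
  filter_upwards [(continuous_columnGram_det i).continuousAt.eventually_ne
    ((columnGram_det_ne_zero_iff X i).mpr hi)] with Y hY
  exact (columnGram_det_ne_zero_iff Y i).mp hY

/-- Lower semicontinuity of the rank: independence of a maximal independent sequence of columns is
an open condition, as a Gram determinant stays nonzero. -/
theorem eventually_rank_le (X : Matrix (Fin d) (Fin n) ℝ) :
    ∀ᶠ Y in 𝓝 X, X.rank ≤ (Y : Matrix (Fin d) (Fin n) ℝ).rank := by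
  obtain ⟨i, hi⟩ := exists_linearIndependent_columns X le_rfl
  filter_upwards [eventually_linearIndependent_columns hi] with Y hY
  exact le_rank_of_linearIndependent_columns hY

theorem columnWeight_orthogonal_mul {g : Matrix (Fin d) (Fin d) ℝ}
    (hg : g ∈ Matrix.orthogonalGroup (Fin d) ℝ) (X : Matrix (Fin d) (Fin n) ℝ) {t : ℕ}
    (i : Fin t → Fin n) (k : Fin n) : columnWeight (g * X) i k = columnWeight X i k := by
  simp only [columnWeight, columnVolume, ← columnGram_det_ne_zero_iff,
    columnGram_orthogonal_mul hg]

theorem totalWeight_orthogonal_mul {g : Matrix (Fin d) (Fin d) ℝ}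
    (hg : g ∈ Matrix.orthogonalGroup (Fin d) ℝ) (X : Matrix (Fin d) (Fin n) ℝ) {t : ℕ}
    (i : Fin t → Fin n) : totalWeight (g * X) i = totalWeight X i := by
  simp only [totalWeight, columnWeight_orthogonal_mul hg]

/-! ### Gram-Schmidt transforms -/

theorem isGramSchmidtTransform_iff {g : Matrix (Fin d) (Fin d) ℝ}
    (hg : g ∈ Matrix.orthogonalGroup (Fin d) ℝ) (X : Matrix (Fin d) (Fin n) ℝ) {r : ℕ}
    (i : Fin r → Fin n) :
    IsGramSchmidtTransform g X i ↔
      (∀ (a : Fin d) (b : Fin r), (b : ℕ) < a → (g.transpose * X.submatrix id i) a b = 0) ∧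
      (∀ (a : Fin d) (b : Fin r), (a : ℕ) = b → 0 ≤ (g.transpose * X.submatrix id i) a b) := by
  rw [IsGramSchmidtTransform, inv_eq_transpose_of_mem_orthogonal hg]
  constructor
  · rintro ⟨A, h1, h2, -, rfl⟩
    exact ⟨h1, h2⟩
  · rintro ⟨h1, h2⟩
    refine ⟨_, h1, h2, ?_, rfl⟩
    rw [transpose_mul_transpose_mul_of_mem_orthogonal hg, columnGram_eq_transpose_mul]

theorem IsGramSchmidtTransform.castLE {g : Matrix (Fin d) (Fin d) ℝ}
    (hg : g ∈ Matrix.orthogonalGroup (Fin d) ℝ) {X : Matrix (Fin d) (Fin n) ℝ} {r s : ℕ}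
    {i : Fin s → Fin n} (h : IsGramSchmidtTransform g X i) (hrs : r ≤ s) :
    IsGramSchmidtTransform g X (fun a : Fin r => i (Fin.castLE hrs a)) := by
  rw [isGramSchmidtTransform_iff hg] at h ⊢
  exact ⟨fun a b hab => h.1 a (Fin.castLE hrs b) hab, fun a b hab => h.2 a (Fin.castLE hrs b) hab⟩

theorem IsGramSchmidtTransform.orthogonal_mul {g h : Matrix (Fin d) (Fin d) ℝ}
    (hg : g ∈ Matrix.orthogonalGroup (Fin d) ℝ) (hh : h ∈ Matrix.orthogonalGroup (Fin d) ℝ)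
    {X : Matrix (Fin d) (Fin n) ℝ} {r : ℕ} {i : Fin r → Fin n}
    (H : IsGramSchmidtTransform h X i) : IsGramSchmidtTransform (g * h) (g * X) i := by
  rw [isGramSchmidtTransform_iff hh] at H
  rw [isGramSchmidtTransform_iff (mul_mem hg hh)]
  have hsub : (g * X).submatrix id i = g * X.submatrix id i := rfl
  have : (g * h).transpose * (g * X).submatrix id i = h.transpose * X.submatrix id i := by
    rw [hsub, Matrix.transpose_mul, Matrix.mul_assoc, ← Matrix.mul_assoc _ g,
      transpose_mul_self_of_mem_orthogonal hg, Matrix.one_mul]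
  rwa [this]

/-- The diagonal entries of an upper triangular matrix with independent columns do not vanish. -/
theorem diag_ne_zero_of_linearIndependent_col {r : ℕ} (hr : r ≤ d) {A : Matrix (Fin d) (Fin r) ℝ}
    (hA : ∀ (a : Fin d) (b : Fin r), (b : ℕ) < a → A a b = 0)
    (hli : LinearIndependent ℝ A.col) (b : Fin r) : A (Fin.castLE hr b) b ≠ 0 := by
  set B : Matrix (Fin r) (Fin r) ℝ := A.submatrix (Fin.castLE hr) id with hB
  have hup : B.IsUpperTriangular := fun a b hab => hA (Fin.castLE hr a) b hab
  -- The rows of `A` from `r` on vanish, so a kernel vector of the top square block `B` is a kernel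
  -- vector of `A`.
  have hdet : B.det ≠ 0 := by
    intro h0
    obtain ⟨v, hv, hBv⟩ := Matrix.exists_mulVec_eq_zero_iff.mpr h0
    apply hv
    have hinj := Matrix.mulVec_injective_iff.mpr hli
    apply hinj
    rw [Matrix.mulVec_zero]
    funext a
    by_cases ha : (a : ℕ) < r
    · exact congrFun hBv ⟨a, ha⟩
    · simp only [Matrix.mulVec, dotProduct, Pi.zero_apply]
      exact Finset.sum_eq_zero fun c _ => by rw [hA a c (by omega), zero_mul]
  rw [Matrix.det_of_isUpperTriangular hup] at hdet
  exact Finset.prod_ne_zero_iff.mp hdet b (Finset.mem_univ _)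

/-- Uniqueness of the Cholesky factor. -/
theorem eq_of_upperTriangular_of_transpose_mul_eq {r : ℕ} (hr : r ≤ d)
    {A A' : Matrix (Fin d) (Fin r) ℝ}
    (hA : ∀ (a : Fin d) (b : Fin r), (b : ℕ) < a → A a b = 0)
    (hA' : ∀ (a : Fin d) (b : Fin r), (b : ℕ) < a → A' a b = 0)
    (hpos : ∀ (a : Fin d) (b : Fin r), (a : ℕ) = b → 0 ≤ A a b)
    (hpos' : ∀ (a : Fin d) (b : Fin r), (a : ℕ) = b → 0 ≤ A' a b)
    (hgram : A.transpose * A = A'.transpose * A')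
    (hli : LinearIndependent ℝ A.col) : A = A' := by
  have hsum : ∀ b c : Fin r, ∑ a, A a b * A a c = ∑ a, A' a b * A' a c := fun b c => by
    simpa [Matrix.mul_apply] using congrFun (congrFun hgram b) c
  have key : ∀ m : ℕ, ∀ b : Fin r, (b : ℕ) = m → ∀ a, A a b = A' a b := by
    intro m
    induction m using Nat.strong_induction_on with
    | _ m ih =>
      intro b hb
      have hcol : ∀ c : Fin r, (c : ℕ) < m → ∀ a, A a c = A' a c := fun c hc => ih c hc c rfl
      -- Forward substitution in the Gram entry `(k, b)`: rows above `k` agree by induction, rows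
      -- below `k` do not contribute because column `k` vanishes there, and the common diagonal
      -- entry of column `k` is nonzero and cancels.
      have hlt : ∀ k : ℕ, ∀ a : Fin d, (a : ℕ) = k → k < m → A a b = A' a b := by
        intro k
        induction k using Nat.strong_induction_on with
        | _ k ihk =>
          intro a ha hk
          have har : k < r := by omega
          have hca : Fin.castLE hr ⟨k, har⟩ = a := Fin.ext ha.symm
          have h1 := hsum ⟨k, har⟩ b
          rw [← Finset.add_sum_erase _ _ (Finset.mem_univ a),
            ← Finset.add_sum_erase _ _ (Finset.mem_univ a)] at h1
          have h2 : ∑ x ∈ Finset.univ.erase a, A x ⟨k, har⟩ * A x b =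
              ∑ x ∈ Finset.univ.erase a, A' x ⟨k, har⟩ * A' x b := by
            refine Finset.sum_congr rfl fun x hx => ?_
            have hxa : (x : ℕ) ≠ a := fun h => (Finset.ne_of_mem_erase hx) (Fin.ext h)
            rcases lt_or_ge (x : ℕ) k with hxk | hxk
            · rw [hcol ⟨k, har⟩ hk, ihk x hxk x rfl (by omega)]
            · rw [hA x ⟨k, har⟩ (by simp only; omega), hA' x ⟨k, har⟩ (by simp only; omega)]
              simp
          rw [h2, add_left_inj, ← hcol ⟨k, har⟩ hk] at h1
          have hne := diag_ne_zero_of_linearIndependent_col hr hA hli ⟨k, har⟩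
          rw [hca] at hne
          exact mul_left_cancel₀ hne h1
      -- The Gram entry `(b, b)` now determines the square of the diagonal entry; its sign is fixed
      -- by non-negativity.
      have hdiag : ∀ a : Fin d, (a : ℕ) = m → A a b = A' a b := by
        intro a ha
        have h1 := hsum b b
        rw [← Finset.add_sum_erase _ _ (Finset.mem_univ a),
            ← Finset.add_sum_erase _ _ (Finset.mem_univ a)] at h1
        have h2 : ∑ x ∈ Finset.univ.erase a, A x b * A x b =
            ∑ x ∈ Finset.univ.erase a, A' x b * A' x b := by
          refine Finset.sum_congr rfl fun x hx => ?_
          have hxa : (x : ℕ) ≠ a := fun h => (Finset.ne_of_mem_erase hx) (Fin.ext h)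
          rcases lt_or_ge (x : ℕ) m with hxk | hxk
          · rw [hlt x x rfl hxk]
          · rw [hA x b (by omega), hA' x b (by omega)]
        rw [h2, add_left_inj] at h1
        exact (mul_self_inj (hpos a b (by omega)) (hpos' a b (by omega))).mp h1
      intro a
      rcases lt_trichotomy (a : ℕ) m with h | h | h
      · exact hlt a a rfl h
      · exact hdiag a h
      · rw [hA a b (by omega), hA' a b (by omega)]
  ext a b
  exact key b b rfl a

theorem linearIndependent_orthogonal_transpose_mul {g : Matrix (Fin d) (Fin d) ℝ}
    (hg : g ∈ Matrix.orthogonalGroup (Fin d) ℝ) {r : ℕ} {B : Matrix (Fin d) (Fin r) ℝ}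
    (hB : LinearIndependent ℝ B.col) : LinearIndependent ℝ (g.transpose * B).col := by
  rw [← Matrix.mulVec_injective_iff] at hB ⊢
  intro v w h
  apply hB
  have h' := congrArg g.mulVec h
  rwa [Matrix.mulVec_mulVec, Matrix.mulVec_mulVec, ← Matrix.mul_assoc,
    mul_transpose_self_of_mem_orthogonal hg, Matrix.one_mul] at h'

theorem le_of_linearIndependent_columns {X : Matrix (Fin d) (Fin n) ℝ} {r : ℕ}
    {i : Fin r → Fin n} (hi : LinearIndependent ℝ (fun a : Fin r => X.col (i a))) : r ≤ d := by
  simpa using hi.fintype_card_le_finrank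

/-- Two Gram-Schmidt transforms of the same independent columns agree on these columns. -/
theorem IsGramSchmidtTransform.transpose_mul_eq {g g' : Matrix (Fin d) (Fin d) ℝ}
    (hg : g ∈ Matrix.orthogonalGroup (Fin d) ℝ) (hg' : g' ∈ Matrix.orthogonalGroup (Fin d) ℝ)
    {X : Matrix (Fin d) (Fin n) ℝ} {r : ℕ} {i : Fin r → Fin n}
    (hi : LinearIndependent ℝ (fun a : Fin r => X.col (i a)))
    (h : IsGramSchmidtTransform g X i) (h' : IsGramSchmidtTransform g' X i) :
    g.transpose * X.submatrix id i = g'.transpose * X.submatrix id i := by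
  rw [isGramSchmidtTransform_iff hg] at h
  rw [isGramSchmidtTransform_iff hg'] at h'
  refine eq_of_upperTriangular_of_transpose_mul_eq (le_of_linearIndependent_columns hi)
    h.1 h'.1 h.2 h'.2 ?_ (linearIndependent_orthogonal_transpose_mul hg hi)
  rw [transpose_mul_transpose_mul_of_mem_orthogonal hg,
    transpose_mul_transpose_mul_of_mem_orthogonal hg']

theorem IsGramSchmidtTransform.mul_transpose_fixes {g g' : Matrix (Fin d) (Fin d) ℝ}
    (hg : g ∈ Matrix.orthogonalGroup (Fin d) ℝ) (hg' : g' ∈ Matrix.orthogonalGroup (Fin d) ℝ)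
    {X : Matrix (Fin d) (Fin n) ℝ} {r : ℕ} {i : Fin r → Fin n}
    (hi : LinearIndependent ℝ (fun a : Fin r => X.col (i a)))
    (h : IsGramSchmidtTransform g X i) (h' : IsGramSchmidtTransform g' X i) :
    (g * g'.transpose) * X.submatrix id i = X.submatrix id i := by
  rw [Matrix.mul_assoc, ← IsGramSchmidtTransform.transpose_mul_eq hg hg' hi h h',
    ← Matrix.mul_assoc, mul_transpose_self_of_mem_orthogonal hg, Matrix.one_mul]

/-- The columns of `g` are the orthonormal basis produced by Gram-Schmidt from the selected columns
padded with zeros. Degenerate steps are filled by arbitrary completing vectors, so independence is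
not needed. -/
theorem exists_orthogonal_isGramSchmidtTransform (X : Matrix (Fin d) (Fin n) ℝ) {r : ℕ}
    (hr : r ≤ d) (i : Fin r → Fin n) :
    ∃ g ∈ Matrix.orthogonalGroup (Fin d) ℝ, IsGramSchmidtTransform g X i := by
  let f : Fin d → EuclideanSpace ℝ (Fin d) := fun b =>
    if h : (b : ℕ) < r then WithLp.toLp 2 (X.col (i ⟨b, h⟩)) else 0
  have hcard : Module.finrank ℝ (EuclideanSpace ℝ (Fin d)) = Fintype.card (Fin d) := by simp
  let e := InnerProductSpace.gramSchmidtOrthonormalBasis hcard f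
  let g : Matrix (Fin d) (Fin d) ℝ := Matrix.of fun a b => e b a
  have hg : g ∈ Matrix.orthogonalGroup (Fin d) ℝ := by
    rw [Matrix.mem_orthogonalGroup_iff']
    ext a b
    have := orthonormal_iff_ite.mp e.orthonormal a b
    rw [Matrix.one_apply, ← this]
    simp [g, Matrix.mul_apply, PiLp.inner_apply, mul_comm]
  have hent : ∀ (a : Fin d) (b : Fin r),
      (g.transpose * X.submatrix id i) a b = inner ℝ (e a) (f (Fin.castLE hr b)) := by
    intro a b
    simp [g, f, Matrix.mul_apply, PiLp.inner_apply, Matrix.col, mul_comm]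
  refine ⟨g, hg, (isGramSchmidtTransform_iff hg X i).mpr ⟨fun a b hab => ?_, fun a b hab => ?_⟩⟩
  · rw [hent]
    exact InnerProductSpace.gramSchmidtOrthonormalBasis_inv_triangular hcard f
      (i := Fin.castLE hr b) hab
  · rw [hent]
    have hb : Fin.castLE hr b = a := Fin.ext hab.symm
    rw [hb]
    -- A diagonal entry is zero at a degenerate step; otherwise it is the inner product of `f a`
    -- with its own normalized orthogonal residual, which is non-negative.
    by_cases h0 : InnerProductSpace.gramSchmidtNormed ℝ f a = 0
    · exact (InnerProductSpace.inner_gramSchmidtOrthonormalBasis_eq_zero hcard h0 a).ge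
    · have h1 : e a = InnerProductSpace.gramSchmidtNormed ℝ f a :=
        InnerProductSpace.gramSchmidtOrthonormalBasis_apply hcard h0
      rw [h1, InnerProductSpace.gramSchmidtNormed, real_inner_smul_left]
      refine mul_nonneg (by simp) ?_
      rw [InnerProductSpace.gramSchmidt_def'' ℝ f a, inner_add_right, inner_sum,
        Finset.sum_eq_zero, add_zero]
      · rw [real_inner_self_eq_norm_sq]; positivity
      · intro c hc
        rw [inner_smul_right, InnerProductSpace.gramSchmidt_orthogonal ℝ f
          (Finset.mem_Iio.mp hc).ne', mul_zero]

theorem det_eq_one_or_neg_one_of_mem_orthogonal {g : Matrix (Fin d) (Fin d) ℝ}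
    (hg : g ∈ Matrix.orthogonalGroup (Fin d) ℝ) : g.det = 1 ∨ g.det = -1 := by
  have h := congrArg Matrix.det (transpose_mul_self_of_mem_orthogonal hg)
  rw [Matrix.det_mul, Matrix.det_transpose, Matrix.det_one] at h
  exact mul_self_eq_one_iff.mp h

/-- If the determinant is `-1`, negate the last column of `g`. This only negates the last row of the
triangular form, which is zero and meets no diagonal entry because `r < d`. -/
theorem exists_rotation_isGramSchmidtTransform (X : Matrix (Fin d) (Fin n) ℝ) {r : ℕ}
    (hr : r < d) (i : Fin r → Fin n) :
    ∃ g ∈ Matrix.specialOrthogonalGroup (Fin d) ℝ, IsGramSchmidtTransform g X i := by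
  obtain ⟨g, hg, h⟩ := exists_orthogonal_isGramSchmidtTransform X hr.le i
  rcases det_eq_one_or_neg_one_of_mem_orthogonal hg with h1 | h1
  · exact ⟨g, Matrix.mem_specialOrthogonalGroup_iff.mpr ⟨hg, h1⟩, h⟩
  · let l : Fin d := ⟨d - 1, by omega⟩
    let D : Matrix (Fin d) (Fin d) ℝ := Matrix.diagonal fun a => if a = l then -1 else 1
    have hD : D ∈ Matrix.orthogonalGroup (Fin d) ℝ := by
      rw [Matrix.mem_orthogonalGroup_iff, Matrix.diagonal_transpose, Matrix.diagonal_mul_diagonal,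
        ← Matrix.diagonal_one]
      congr 1
      funext a
      split_ifs <;> simp
    have hdet : D.det = -1 := by
      rw [Matrix.det_diagonal, Finset.prod_ite_eq' Finset.univ l fun _ => (-1 : ℝ)]
      simp
    have hmem := mul_mem hg hD
    refine ⟨g * D, Matrix.mem_specialOrthogonalGroup_iff.mpr ⟨hmem, ?_⟩, ?_⟩
    · rw [Matrix.det_mul, h1, hdet]; norm_num
    · rw [isGramSchmidtTransform_iff hg] at h
      rw [isGramSchmidtTransform_iff hmem]
      have hent : ∀ (a : Fin d) (b : Fin r),
          ((g * D).transpose * X.submatrix id i) a b =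
            (if a = l then -1 else 1) * (g.transpose * X.submatrix id i) a b := by
        intro a b
        rw [Matrix.transpose_mul, Matrix.mul_assoc, Matrix.diagonal_transpose,
          Matrix.diagonal_mul]
      refine ⟨fun a b hab => by rw [hent, h.1 a b hab, mul_zero], fun a b hab => ?_⟩
      rw [hent, if_neg, one_mul]
      · exact h.2 a b hab
      · intro hal
        have : (a : ℕ) = d - 1 := congrArg Fin.val hal
        omega

theorem eq_one_of_orthogonal_of_diag_eq_one {u : Matrix (Fin d) (Fin d) ℝ}
    (hu : u ∈ Matrix.orthogonalGroup (Fin d) ℝ) (hdiag : ∀ a, u a a = 1) : u = 1 := by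
  ext a b
  by_cases hab : a = b
  · rw [hab, Matrix.one_apply_eq, hdiag]
  · rw [Matrix.one_apply_ne hab]
    have h := congrFun (congrFun (mul_transpose_self_of_mem_orthogonal hu) a) a
    rw [Matrix.mul_apply, Matrix.one_apply_eq, ← Finset.add_sum_erase _ _ (Finset.mem_univ a),
      Matrix.transpose_apply, hdiag, mul_one, add_eq_left] at h
    have h' := (Finset.sum_eq_zero_iff_of_nonneg fun c _ => mul_self_nonneg (u a c)).mp h b
      (Finset.mem_erase.mpr ⟨Ne.symm hab, Finset.mem_univ b⟩)
    exact mul_self_eq_zero.mp h'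

/-- A rotation fixing `d - 1` independent vectors is the identity. -/
theorem eq_one_of_rotation_fixes {u : Matrix (Fin d) (Fin d) ℝ}
    (hu : u ∈ Matrix.specialOrthogonalGroup (Fin d) ℝ) {X : Matrix (Fin d) (Fin n) ℝ} {r : ℕ}
    (hr : d ≤ r + 1) {i : Fin r → Fin n}
    (hi : LinearIndependent ℝ (fun a : Fin r => X.col (i a)))
    (hfix : u * X.submatrix id i = X.submatrix id i) : u = 1 := by
  have hrd := le_of_linearIndependent_columns hi
  obtain ⟨huo, hud⟩ := Matrix.mem_specialOrthogonalGroup_iff.mp hu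
  obtain ⟨g, hg, hgs⟩ := exists_orthogonal_isGramSchmidtTransform X hrd i
  rw [isGramSchmidtTransform_iff hg] at hgs
  have hgt : g.transpose ∈ Matrix.orthogonalGroup (Fin d) ℝ := by
    rw [Matrix.mem_orthogonalGroup_iff, Matrix.transpose_transpose]
    exact transpose_mul_self_of_mem_orthogonal hg
  set B := g.transpose * X.submatrix id i with hB
  -- Conjugation by a Gram-Schmidt transform replaces the fixed vectors by the columns of the upper
  -- triangular `B`.
  set M := g.transpose * u * g with hM
  have hMo : M ∈ Matrix.orthogonalGroup (Fin d) ℝ := mul_mem (mul_mem hgt huo) hg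
  have hMdet : M.det = 1 := by
    rw [hM, Matrix.det_mul, Matrix.det_mul, hud, mul_one, ← Matrix.det_mul,
      transpose_mul_self_of_mem_orthogonal hg, Matrix.det_one]
  have hMB : M * B = B := by
    rw [hM, hB, Matrix.mul_assoc, ← Matrix.mul_assoc g, mul_transpose_self_of_mem_orthogonal hg,
      Matrix.one_mul, Matrix.mul_assoc, hfix]
  have hli : LinearIndependent ℝ B.col := linearIndependent_orthogonal_transpose_mul hg hi
  -- `M - 1` annihilates column `m` of `B`. Its earlier columns are already zero and `B` vanishes
  -- below row `m`, so column `m` of `M - 1` times a nonzero diagonal entry is zero.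
  have hcols : ∀ m : ℕ, ∀ c : Fin d, (c : ℕ) = m → m < r →
      ∀ a, M a c = (1 : Matrix (Fin d) (Fin d) ℝ) a c := by
    intro m
    induction m using Nat.strong_induction_on with
    | _ m ih =>
      intro c hc hm a
      have h0 : ∑ x, (M - 1) a x * B x ⟨m, hm⟩ = 0 := by
        rw [← Matrix.mul_apply, Matrix.sub_mul, hMB, Matrix.one_mul, sub_self, Matrix.zero_apply]
      rw [Finset.sum_eq_single c] at h0
      · have hne := diag_ne_zero_of_linearIndependent_col hrd hgs.1 hli ⟨m, hm⟩
        have hcc : Fin.castLE hrd ⟨m, hm⟩ = c := Fin.ext hc.symm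
        rw [hcc] at hne
        exact sub_eq_zero.mp ((mul_eq_zero.mp h0).resolve_right hne)
      · intro x _ hx
        have hxc : (x : ℕ) ≠ c := fun h => hx (Fin.ext h)
        rcases lt_or_ge (x : ℕ) m with h | h
        · rw [Matrix.sub_apply, ih x h x rfl (by omega), sub_self, zero_mul]
        · rw [hgs.1 x ⟨m, hm⟩ (by simp only; omega), mul_zero]
      · exact fun h => absurd (Finset.mem_univ c) h
  have hup : M.IsUpperTriangular := fun a c hac => by
    have hac' : (c : ℕ) < a := hac
    rw [hcols c c rfl (by omega), Matrix.one_apply_ne (by rintro rfl; exact lt_irrefl _ hac')]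
  have hone : M = 1 := by
    refine eq_one_of_orthogonal_of_diag_eq_one hMo fun a => ?_
    by_cases ha : (a : ℕ) < r
    · rw [hcols a a rfl ha, Matrix.one_apply_eq]
    -- At most one column of `M` lies outside the first `r`; `det M = 1` makes its diagonal entry
    -- `1`.
    · rw [Matrix.det_of_isUpperTriangular hup, Finset.prod_eq_single a] at hMdet
      · exact hMdet
      · intro c _ hca
        have hca' : (c : ℕ) ≠ a := fun h => hca (Fin.ext h)
        rw [hcols c c rfl (by omega), Matrix.one_apply_eq]
      · exact fun h => absurd (Finset.mem_univ a) h
  calc u = g * M * g.transpose := by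
        rw [hM, Matrix.mul_assoc g.transpose, ← Matrix.mul_assoc g,
          mul_transpose_self_of_mem_orthogonal hg, Matrix.one_mul, Matrix.mul_assoc,
          mul_transpose_self_of_mem_orthogonal hg, Matrix.mul_one]
    _ = 1 := by rw [hone, Matrix.mul_one, mul_transpose_self_of_mem_orthogonal hg]

/-- By dimension the selected columns span the whole column space, so a linear map fixing them fixes
every column. -/
theorem orthogonal_mul_eq_of_fixes {u : Matrix (Fin d) (Fin d) ℝ} {X : Matrix (Fin d) (Fin n) ℝ}
    {k : ℕ} (hk : X.rank ≤ k) {i : Fin k → Fin n}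
    (hi : LinearIndependent ℝ (fun a => X.col (i a)))
    (hfix : u * X.submatrix id i = X.submatrix id i) : u * X = X := by
  have hle : Submodule.span ℝ (Set.range fun a => X.col (i a)) ≤
      Submodule.span ℝ (Set.range X.col) := by
    refine Submodule.span_mono ?_
    rintro _ ⟨k, rfl⟩
    exact ⟨_, rfl⟩
  have heq := Submodule.eq_of_le_of_finrank_le hle (by
    rw [← Matrix.rank_eq_finrank_span_cols, finrank_span_eq_card hi, Fintype.card_fin]; exact hk)
  have hmem : Submodule.span ℝ (Set.range fun a => X.col (i a)) ≤
      LinearMap.ker (u.mulVecLin - LinearMap.id) := by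
    rw [Submodule.span_le]
    rintro _ ⟨k, rfl⟩
    rw [SetLike.mem_coe, LinearMap.mem_ker, LinearMap.sub_apply, sub_eq_zero]
    funext a
    exact congrFun (congrFun hfix a) k
  rw [heq] at hmem
  ext a k
  have h := hmem (Submodule.subset_span ⟨k, rfl⟩)
  rw [LinearMap.mem_ker, LinearMap.sub_apply, sub_eq_zero] at h
  exact congrFun h a

end LinearAlgebra

/-! ### Weights: normalization, support, marginals and continuity. -/

section Weights

variable {d n : ℕ}

theorem columnWeight_nonneg (X : Matrix (Fin d) (Fin n) ℝ) {t : ℕ} (i : Fin t → Fin n)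
    (k : Fin n) : 0 ≤ columnWeight X i k := by
  rw [columnWeight]
  split_ifs
  · exact div_nonneg (columnVolume_nonneg _ _)
      (Finset.sum_nonneg fun _ _ => columnVolume_nonneg _ _)
  · positivity

theorem columnWeight_le_one (X : Matrix (Fin d) (Fin n) ℝ) {t : ℕ} (i : Fin t → Fin n)
    (k : Fin n) : columnWeight X i k ≤ 1 := by
  rw [columnWeight]
  split_ifs
  · exact div_le_one_of_le₀ (Finset.single_le_sum (f := fun k =>
      columnVolume X (Fin.snoc i k : Fin (t + 1) → Fin n))
      (fun _ _ => columnVolume_nonneg _ _) (Finset.mem_univ k))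
      (Finset.sum_nonneg fun _ _ => columnVolume_nonneg _ _)
  · have hn : 1 ≤ n := Nat.one_le_iff_ne_zero.mpr fun h => (h ▸ k).elim0
    exact div_le_one_of_le₀ (by exact_mod_cast hn) (by positivity)

theorem sum_columnVolume_snoc_pos (X : Matrix (Fin d) (Fin n) ℝ) {t : ℕ} (i : Fin t → Fin n)
    (hi : LinearIndependent ℝ (fun a : Fin t => X.col (i a))) (ht : t < X.rank) :
    0 < ∑ k : Fin n, columnVolume X (Fin.snoc i k : Fin (t + 1) → Fin n) := by
  obtain ⟨k, hk⟩ := exists_linearIndependent_snoc X i hi ht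
  exact Finset.sum_pos' (fun _ _ => columnVolume_nonneg _ _)
    ⟨k, Finset.mem_univ k,
      (columnVolume_nonneg _ _).lt_of_ne' ((columnVolume_ne_zero_iff X _).mpr hk)⟩

theorem sum_columnWeight (X : Matrix (Fin d) (Fin n) ℝ) {t : ℕ} (i : Fin t → Fin n)
    (ht : t < X.rank) : ∑ k, columnWeight X i k = 1 := by
  by_cases hi : LinearIndependent ℝ (fun a : Fin t => X.col (i a))
  · simp only [columnWeight, if_pos hi]
    rw [← Finset.sum_div]
    exact div_self (sum_columnVolume_snoc_pos X i hi ht).ne'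
  · have hn : n ≠ 0 := by
      have := X.rank_le_width
      omega
    simp [columnWeight, if_neg hi, hn]

theorem totalWeight_nonneg (X : Matrix (Fin d) (Fin n) ℝ) {t : ℕ} (i : Fin t → Fin n) :
    0 ≤ totalWeight X i :=
  Finset.prod_nonneg fun _ _ => columnWeight_nonneg _ _ _

theorem totalWeight_zero_length (X : Matrix (Fin d) (Fin n) ℝ) (i : Fin 0 → Fin n) :
    totalWeight X i = 1 := by
  simp [totalWeight]

theorem totalWeight_snoc (X : Matrix (Fin d) (Fin n) ℝ) {t : ℕ} (i : Fin t → Fin n) (k : Fin n) :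
    totalWeight X (Fin.snoc i k : Fin (t + 1) → Fin n) = totalWeight X i * columnWeight X i k := by
  have hcast : ∀ (s : ℕ) (hs : s ≤ t) (hs' : s ≤ t + 1) (a : Fin s),
      (Fin.snoc i k : Fin (t + 1) → Fin n) (Fin.castLE hs' a) = i (Fin.castLE hs a) := by
    intro s hs hs' a
    have : Fin.castLE hs' a = Fin.castSucc (Fin.castLE hs a) := rfl
    rw [this, Fin.snoc_castSucc]
  rw [totalWeight, Fin.prod_univ_castSucc, totalWeight]
  congr 1
  · refine Finset.prod_congr rfl fun s _ => ?_
    rw [Fin.snoc_castSucc]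
    congr 1
    funext a
    exact hcast s s.isLt.le _ a
  · rw [Fin.snoc_last]
    congr 1
    funext a
    exact hcast t le_rfl _ a

theorem linearIndependent_snoc_of_columnWeight_ne_zero {X : Matrix (Fin d) (Fin n) ℝ} {t : ℕ}
    {i : Fin t → Fin n} {k : Fin n} (hi : LinearIndependent ℝ (fun a : Fin t => X.col (i a)))
    (h : columnWeight X i k ≠ 0) : LinearIndependent ℝ
      (fun a : Fin (t + 1) => X.col ((Fin.snoc i k : Fin (t + 1) → Fin n) a)) := by
  rw [columnWeight, if_pos hi] at h
  exact (columnVolume_ne_zero_iff X _).mp (div_ne_zero_iff.mp h).1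

/-- The first index that makes the sequence dependent contributes a vanishing volume, hence a zero
factor; the default value `1 / n` only appears after it. -/
theorem linearIndependent_of_totalWeight_ne_zero {X : Matrix (Fin d) (Fin n) ℝ} {t : ℕ}
    {i : Fin t → Fin n} (h : totalWeight X i ≠ 0) :
    LinearIndependent ℝ (fun a : Fin t => X.col (i a)) := by
  induction t with
  | zero => exact linearIndependent_empty_type
  | succ t ih =>
    rw [← Fin.snoc_init_self i] at h ⊢
    rw [totalWeight_snoc] at h
    exact linearIndependent_snoc_of_columnWeight_ne_zero (ih (mul_ne_zero_iff.mp h).1)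
      (mul_ne_zero_iff.mp h).2

theorem totalWeight_ne_zero {X : Matrix (Fin d) (Fin n) ℝ} {t : ℕ}
    {i : Fin t → Fin n} (h : LinearIndependent ℝ (fun a : Fin t => X.col (i a))) :
    totalWeight X i ≠ 0 := by
  induction t with
  | zero => simp [totalWeight]
  | succ t ih =>
    rw [← Fin.snoc_init_self i] at h ⊢
    have hrank : t + 1 ≤ X.rank := le_rank_of_linearIndependent_columns h
    have hinit : LinearIndependent ℝ
        (fun a : Fin t => X.col (Fin.init (α := fun _ => Fin n) i a)) := by
      rw [col_snoc, linearIndependent_finSnoc] at h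
      exact h.1
    rw [totalWeight_snoc]
    refine mul_ne_zero (ih hinit) ?_
    rw [columnWeight, if_pos hinit]
    exact div_ne_zero ((columnVolume_ne_zero_iff X _).mpr h)
      (sum_columnVolume_snoc_pos X _ hinit (by omega)).ne'

/-- Summing out the last indices of the weights. -/
theorem sum_totalWeight_castLE (X : Matrix (Fin d) (Fin n) ℝ) {r s : ℕ} (hrs : r ≤ s)
    (hs : s ≤ X.rank) (f : (Fin r → Fin n) → ℝ) :
    ∑ i : Fin s → Fin n, totalWeight X i * f (fun a => i (Fin.castLE hrs a)) =
      ∑ j : Fin r → Fin n, totalWeight X j * f j := by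
  induction s, hrs using Nat.le_induction with
  | base => simp
  | succ s hrs ih =>
    rw [← ih (by omega), ← (Fin.snocEquiv fun _ : Fin (s + 1) => Fin n).sum_comp,
      Fintype.sum_prod_type_right]
    refine Finset.sum_congr rfl fun i _ => ?_
    have h : ∀ k : Fin n,
        (fun a : Fin r => (Fin.snocEquiv fun _ : Fin (s + 1) => Fin n) (k, i)
          (Fin.castLE (hrs.trans (Nat.le_succ s)) a)) = fun a => i (Fin.castLE hrs a) := by
      intro k
      funext a
      have : Fin.castLE (hrs.trans (Nat.le_succ s)) a = Fin.castSucc (Fin.castLE hrs a) := rfl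
      rw [this]
      exact Fin.snoc_castSucc (α := fun _ => Fin n) k i _
    simp_rw [h, ← Finset.sum_mul]
    congr 1
    have h' : ∀ k : Fin n, totalWeight X ((Fin.snocEquiv fun _ : Fin (s + 1) => Fin n) (k, i)) =
        totalWeight X i * columnWeight X i k := fun k => totalWeight_snoc X i k
    simp_rw [h', ← Finset.mul_sum]
    rw [sum_columnWeight X i (by omega), mul_one]

theorem sum_totalWeight (X : Matrix (Fin d) (Fin n) ℝ) {s : ℕ} (hs : s ≤ X.rank) :
    ∑ i : Fin s → Fin n, totalWeight X i = 1 := by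
  have h := sum_totalWeight_castLE X (Nat.zero_le s) hs fun _ => 1
  simpa [totalWeight_zero_length] using h

theorem continuousAt_columnWeight {X : Matrix (Fin d) (Fin n) ℝ} {t : ℕ} {i : Fin t → Fin n}
    (hi : LinearIndependent ℝ (fun a : Fin t => X.col (i a))) (ht : t < X.rank) (k : Fin n) :
    ContinuousAt (fun Y : Matrix (Fin d) (Fin n) ℝ => columnWeight Y i k) X := by
  have hc : ContinuousAt (fun Y : Matrix (Fin d) (Fin n) ℝ =>
      columnVolume Y (Fin.snoc i k : Fin (t + 1) → Fin n) /
        ∑ k : Fin n, columnVolume Y (Fin.snoc i k : Fin (t + 1) → Fin n)) X :=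
    (continuous_columnVolume _).continuousAt.div
      (continuous_finsetSum _ fun _ _ => continuous_columnVolume _).continuousAt
      (sum_columnVolume_snoc_pos X i hi ht).ne'
  refine hc.congr ?_
  filter_upwards [eventually_linearIndependent_columns hi] with Y hY
  rw [columnWeight, if_pos hY]

/-- A single factor may jump where the preceding columns become dependent. There the product of the
preceding factors tends to zero while the factor stays in `[0, 1]`, so the product is still
continuous. -/
theorem continuousAt_totalWeight {X : Matrix (Fin d) (Fin n) ℝ} {t : ℕ} (ht : t ≤ X.rank)
    (i : Fin t → Fin n) :
    ContinuousAt (fun Y : Matrix (Fin d) (Fin n) ℝ => totalWeight Y i) X := by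
  induction t with
  | zero => simpa [totalWeight] using continuousAt_const
  | succ t ih =>
    rw [← Fin.snoc_init_self i]
    simp only [totalWeight_snoc]
    have hprev := ih (by omega) (Fin.init (α := fun _ => Fin n) i)
    by_cases hi : LinearIndependent ℝ
        (fun a : Fin t => X.col (Fin.init (α := fun _ => Fin n) i a))
    · exact hprev.mul (continuousAt_columnWeight hi (by omega) _)
    · have h0 : totalWeight X (Fin.init (α := fun _ => Fin n) i) = 0 := by
        by_contra h
        exact hi (linearIndependent_of_totalWeight_ne_zero h)
      rw [ContinuousAt, h0] at hprev
      rw [ContinuousAt, h0, zero_mul]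
      exact squeeze_zero (fun Y => mul_nonneg (totalWeight_nonneg _ _) (columnWeight_nonneg _ _ _))
        (fun Y => mul_le_of_le_one_right (totalWeight_nonneg _ _) (columnWeight_le_one _ _ _))
        hprev

end Weights

/-! ### Haar measure on stabilizers and averaging. -/

section StabilizerLaw

variable {G V : Type*} [Group G] [TopologicalSpace G] [IsTopologicalGroup G] [CompactSpace G]
  [TopologicalSpace V] [T2Space V] [MulAction G V] [ContinuousSMul G V]
  [MeasurableSpace G] [BorelSpace G]

instance stabilizerHaar_isHaarMeasure (v : V) :
    (stabilizerHaar (G := G) v).IsHaarMeasure := by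
  unfold stabilizerHaar
  infer_instance

/-- The Haar probability measure of the stabilizer of `v`, as a measure on `G`. -/
noncomputable def stabilizerLaw (v : V) : Measure G :=
  (stabilizerHaar (G := G) v).map Subtype.val

instance stabilizerLaw_isProbabilityMeasure (v : V) :
    IsProbabilityMeasure (stabilizerLaw (G := G) v) :=
  stabilizerHaar_map_isProbabilityMeasure v

theorem stabilizerLaw_map_mul_left (v : V) {s : G} (hs : s • v = v) :
    (stabilizerLaw v).map (fun h => s * h) = stabilizerLaw v := by
  let s' : MulAction.stabilizer G v := ⟨s, hs⟩
  rw [stabilizerLaw, Measure.map_map (measurable_const_mul s) measurable_subtype_coe]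
  have h : (fun h : G => s * h) ∘ (Subtype.val : MulAction.stabilizer G v → G) =
      Subtype.val ∘ fun h => s' * h := rfl
  rw [h, ← Measure.map_map measurable_subtype_coe (measurable_const_mul s'),
    map_mul_left_eq_self]

/-- Conjugation by `g` is a continuous isomorphism of the compact stabilizers, so it carries one
Haar probability measure to the other. -/
theorem stabilizerLaw_smul (v : V) (g : G) :
    stabilizerLaw (g • v) = (stabilizerLaw v).map fun h => g * h * g⁻¹ := by
  let e : MulAction.stabilizer G v ≃* MulAction.stabilizer G (g • v) :=
    MulAction.stabilizerEquivStabilizer (a := v) (b := g • v) (g := g) rfl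
  have hval : ∀ s, (e s : G) = g * s * g⁻¹ := fun s => rfl
  have hcont : Continuous e := by
    refine continuous_induced_rng.mpr ?_
    exact (continuous_const.mul continuous_subtype_val).mul continuous_const
  have hmp : MeasurePreserving e (stabilizerHaar (G := G) v) (stabilizerHaar (G := G) (g • v)) :=
    MonoidHom.measurePreserving (f := e.toMonoidHom) hcont e.surjective
      (by rw [measure_univ, measure_univ])
  have hm : Measurable fun h : G => g * h * g⁻¹ :=
    (measurable_const_mul g).mul_const _
  rw [stabilizerLaw, stabilizerLaw, ← hmp.map_eq,
    Measure.map_map measurable_subtype_coe hmp.measurable,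
    Measure.map_map hm measurable_subtype_coe]
  rfl

/-- Right translation by `s` is conjugation by `s⁻¹` followed by left translation by `s`, up to
order, and the law is invariant under both. -/
theorem stabilizerLaw_map_mul_right (v : V) {s : G} (hs : s • v = v) :
    (stabilizerLaw v).map (fun h => h * s) = stabilizerLaw v := by
  have hm : Measurable fun h : G => s * h * s⁻¹ := (measurable_const_mul s).mul_const _
  have h : stabilizerLaw v = (stabilizerLaw v).map fun h : G => s * h * s⁻¹ := by
    rw [← stabilizerLaw_smul, hs]
  conv_lhs => rw [h]
  rw [Measure.map_map (measurable_mul_const s) hm]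
  have h2 : (fun h : G => h * s) ∘ (fun h : G => s * h * s⁻¹) = fun h => s * h := by
    funext x
    simp
  rw [h2, stabilizerLaw_map_mul_left v hs]

theorem lintegral_stabilizerLaw_mul_stabilizer (v : V) {s : G} (hs : s • v = v) (h : G)
    {f : G → ℝ≥0∞} (hf : Measurable f) :
    ∫⁻ x, f (x * (s * h)) ∂(stabilizerLaw v) = ∫⁻ x, f (x * h) ∂(stabilizerLaw v) := by
  conv_rhs => rw [← stabilizerLaw_map_mul_right v hs]
  rw [lintegral_map (f := fun x => f (x * h)) (hf.comp (measurable_mul_const h))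
    (measurable_mul_const s)]
  simp only [mul_assoc]

theorem lintegral_stabilizerLaw_smul (v : V) (g h : G) {f : G → ℝ≥0∞} (hf : Measurable f) :
    ∫⁻ x, f (x * (g * h)) ∂(stabilizerLaw (g • v)) =
      ∫⁻ x, f (g * (x * h)) ∂(stabilizerLaw v) := by
  rw [stabilizerLaw_smul, lintegral_map (f := fun x => f (x * (g * h)))
    (hf.comp (measurable_mul_const _)) ((measurable_const_mul g).mul_const _)]
  simp [mul_assoc]

theorem integral_stabilizerLaw_mul_stabilizer (v : V) {s : G} (hs : s • v = v) (h : G)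
    {f : G → ℝ} (hf : Continuous f) :
    ∫ x, f (x * (s * h)) ∂(stabilizerLaw v) = ∫ x, f (x * h) ∂(stabilizerLaw v) := by
  conv_rhs => rw [← stabilizerLaw_map_mul_right v hs]
  rw [integral_map (f := fun x => f (x * h)) (measurable_mul_const s).aemeasurable
    (hf.comp (continuous_mul_const h)).aestronglyMeasurable]
  simp only [mul_assoc]

theorem lintegral_stabilizerLaw_of_fixed {v : V} (hv : ∀ g : G, g • v = v) (h : G)
    {f : G → ℝ≥0∞} (hf : Measurable f) :
    ∫⁻ x, f (x * h) ∂(stabilizerLaw v) = ∫⁻ x, f x ∂(stabilizerLaw v) := by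
  simpa using lintegral_stabilizerLaw_mul_stabilizer v (hv h) 1 hf

variable [SecondCountableTopology G]

theorem lintegral_stabilizerAverage (v : V) (τ : ProbabilityMeasure G) {f : G → ℝ≥0∞}
    (hf : Measurable f) :
    ∫⁻ x, f x ∂(stabilizerAverage v τ : Measure G) =
      ∫⁻ h, ∫⁻ x, f (x * h) ∂(stabilizerLaw v) ∂(τ : Measure G) := by
  have h : (stabilizerAverage v τ : Measure G) = (stabilizerLaw v).mconv (τ : Measure G) := rfl
  rw [h, Measure.lintegral_mconv hf, lintegral_lintegral_swap]
  exact (hf.comp measurable_mul).aemeasurable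

theorem integral_stabilizerAverage (v : V) (τ : ProbabilityMeasure G)
    (f : BoundedContinuousFunction G ℝ) :
    ∫ x, f x ∂(stabilizerAverage v τ : Measure G) =
      ∫ h, ∫ x, f (x * h) ∂(stabilizerLaw v) ∂(τ : Measure G) := by
  have h : (stabilizerAverage v τ : Measure G) = (stabilizerLaw v).mconv (τ : Measure G) := rfl
  have hint : Integrable f ((stabilizerLaw v).mconv (τ : Measure G)) := by
    rw [← h]
    exact f.integrable _
  rw [h, integral_mconv hint, integral_integral_swap]
  exact (integrable_map_measure hint.1 (by fun_prop)).mp hint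

theorem continuous_integral_stabilizerLaw (v : V) (f : BoundedContinuousFunction G ℝ) :
    Continuous fun h : G => ∫ x, f (x * h) ∂(stabilizerLaw v) := by
  refine continuous_of_dominated (bound := fun _ => ‖f‖) (fun h => ?_) (fun h => ?_)
    (integrable_const _) ?_
  · exact (f.continuous.comp (continuous_mul_const h)).aestronglyMeasurable
  · exact Eventually.of_forall fun x => f.norm_coe_le_norm _
  · exact Eventually.of_forall fun x => f.continuous.comp (continuous_const_mul x)

/-- Here the stabilizer is all of `G`, and its invariant law absorbs `τ`. This is why the measure at
the origin may be arbitrary. -/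
theorem stabilizerAverage_of_fixed {v : V} (hv : ∀ g : G, g • v = v)
    (τ : ProbabilityMeasure G) : (stabilizerAverage v τ : Measure G) = stabilizerLaw v := by
  refine Measure.ext_of_lintegral _ fun f hf => ?_
  rw [lintegral_stabilizerAverage v τ hf]
  simp_rw [lintegral_stabilizerLaw_of_fixed hv _ hf]
  simp

end StabilizerLaw

/-! ### Weak equivariance and continuity, uniformly for both groups. -/

section Robustness

variable {d n : ℕ}

/-- The group `G` acts on point clouds through orthogonal matrices, and `r` is a length of index
sequences for which independent columns determine the stabilizer of a point cloud. -/
structure IsAdmissibleLength {G : Type*} [Group G] [TopologicalSpace G]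
    [MulAction G (Matrix (Fin d) (Fin n) ℝ)] (φ : G →* Matrix (Fin d) (Fin d) ℝ)
    (r : Matrix (Fin d) (Fin n) ℝ → ℕ) : Prop where
  continuous : Continuous φ
  mem_orthogonal : ∀ g, φ g ∈ Matrix.orthogonalGroup (Fin d) ℝ
  smul_eq : ∀ (g : G) (X : Matrix (Fin d) (Fin n) ℝ), g • X = φ g * X
  le_rank : ∀ X, r X ≤ X.rank
  length_smul : ∀ (g : G) (X : Matrix (Fin d) (Fin n) ℝ), r (g • X) = r X
  eventually_le : ∀ X, ∀ᶠ Y in 𝓝 X, r X ≤ r Y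
  fixes : ∀ (X : Matrix (Fin d) (Fin n) ℝ) (i : Fin (r X) → Fin n),
    LinearIndependent ℝ (fun a => X.col (i a)) →
      ∀ g, φ g * X.submatrix id i = X.submatrix id i → φ g * X = X

/-- The lengths at `g • X` and at `X` are equal but not definitionally so; this transports sums
between the two index types. -/
theorem sum_eq_sum_of_length_eq {M : Type*} [AddCommMonoid M] {k l : ℕ} (h : k = l)
    (f : (Fin k → Fin n) → M) (f' : (Fin l → Fin n) → M)
    (H : ∀ i : Fin k → Fin n, f i = f' fun a => i (Fin.cast h.symm a)) :
    ∑ i, f i = ∑ i, f' i := by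
  subst h
  exact Finset.sum_congr rfl fun i _ => H i

theorem totalWeight_cast {k l : ℕ} (h : k = l) (X : Matrix (Fin d) (Fin n) ℝ)
    (i : Fin k → Fin n) : totalWeight X (fun a => i (Fin.cast h.symm a)) = totalWeight X i := by
  subst h
  rfl

/-- The weights of the index sequences of length `s` define a probability measure. -/
theorem isProbabilityMeasure_sum_totalWeight_dirac {G : Type*} [MeasurableSpace G]
    (X : Matrix (Fin d) (Fin n) ℝ) {s : ℕ} (hs : s ≤ X.rank) (γ : (Fin s → Fin n) → G) :
    IsProbabilityMeasure
      (∑ i : Fin s → Fin n, ENNReal.ofReal (totalWeight X i) • Measure.dirac (γ i)) := by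
  constructor
  rw [Measure.finsetSum_apply]
  simp only [Measure.smul_apply, measure_univ, smul_eq_mul, mul_one]
  rw [← ENNReal.ofReal_sum_of_nonneg fun _ _ => totalWeight_nonneg _ _, sum_totalWeight X hs,
    ENNReal.ofReal_one]

variable {G : Type*} [Group G] [TopologicalSpace G] [MulAction G (Matrix (Fin d) (Fin n) ℝ)]
  {φ : G →* Matrix (Fin d) (Fin d) ℝ} {r : Matrix (Fin d) (Fin n) ℝ → ℕ}

theorem IsAdmissibleLength.map_inv (hr : IsAdmissibleLength φ r) (g : G) :
    φ g⁻¹ = (φ g).transpose := by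
  rw [← inv_eq_transpose_of_mem_orthogonal (hr.mem_orthogonal g)]
  refine (Matrix.inv_eq_left_inv ?_).symm
  rw [← map_mul, inv_mul_cancel, map_one]

theorem IsAdmissibleLength.totalWeight_smul (hr : IsAdmissibleLength φ r) (g : G)
    (X : Matrix (Fin d) (Fin n) ℝ) {t : ℕ} (i : Fin t → Fin n) :
    totalWeight (g • X) i = totalWeight X i := by
  rw [hr.smul_eq, totalWeight_orthogonal_mul (hr.mem_orthogonal g)]

theorem IsAdmissibleLength.isGramSchmidtTransform_smul (hr : IsAdmissibleLength φ r)
    {X : Matrix (Fin d) (Fin n) ℝ} {t : ℕ} {i : Fin t → Fin n} {h : G}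
    (H : IsGramSchmidtTransform (φ h) X i) (g : G) :
    IsGramSchmidtTransform (φ (g * h)) (g • X) i := by
  rw [map_mul, hr.smul_eq]
  exact H.orthogonal_mul (hr.mem_orthogonal g) (hr.mem_orthogonal _)

/-- Two Gram-Schmidt transforms of the same columns differ by an element of the stabilizer. -/
theorem IsAdmissibleLength.mul_inv_smul (hr : IsAdmissibleLength φ r)
    {X : Matrix (Fin d) (Fin n) ℝ} {i : Fin (r X) → Fin n}
    (hi : LinearIndependent ℝ (fun a => X.col (i a))) {g g' : G}
    (h : IsGramSchmidtTransform (φ g) X i) (h' : IsGramSchmidtTransform (φ g') X i) :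
    (g * g'⁻¹) • X = X := by
  rw [hr.smul_eq]
  refine hr.fixes X i hi _ ?_
  rw [map_mul, hr.map_inv]
  exact IsGramSchmidtTransform.mul_transpose_fixes (hr.mem_orthogonal g) (hr.mem_orthogonal g')
    hi h h'

theorem IsAdmissibleLength.eq_of_invariant (hr : IsAdmissibleLength φ r)
    {X : Matrix (Fin d) (Fin n) ℝ} {i : Fin (r X) → Fin n}
    (hi : LinearIndependent ℝ (fun a => X.col (i a))) {g g' : G}
    (h : IsGramSchmidtTransform (φ g) X i) (h' : IsGramSchmidtTransform (φ g') X i)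
    {M : Type*} {F : G → M} (hF : ∀ s : G, s • X = X → ∀ x, F (s * x) = F x) : F g = F g' := by
  have h1 := hF _ (hr.mul_inv_smul hi h h') g'
  rwa [inv_mul_cancel_right] at h1

theorem IsAdmissibleLength.isClosed_isGramSchmidtTransform [IsTopologicalGroup G]
    (hr : IsAdmissibleLength φ r) {s : ℕ} (i : Fin s → Fin n) :
    IsClosed {p : Matrix (Fin d) (Fin n) ℝ × G | IsGramSchmidtTransform (φ p.2) p.1 i} := by
  have hc : Continuous fun p : Matrix (Fin d) (Fin n) ℝ × G =>
      (φ p.2).transpose * p.1.submatrix id i := by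
    have h1 : Continuous fun p : Matrix (Fin d) (Fin n) ℝ × G => p.1.submatrix id i :=
      continuous_fst.matrix_submatrix _ _
    exact (hr.continuous.comp continuous_snd).matrix_transpose.matrix_mul h1
  have hset : {p : Matrix (Fin d) (Fin n) ℝ × G | IsGramSchmidtTransform (φ p.2) p.1 i} =
      (⋂ (a : Fin d) (b : Fin s) (_ : (b : ℕ) < a),
        {p | ((φ p.2).transpose * p.1.submatrix id i) a b = 0}) ∩
      ⋂ (a : Fin d) (b : Fin s) (_ : (a : ℕ) = b),
        {p | 0 ≤ ((φ p.2).transpose * p.1.submatrix id i) a b} := by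
    ext p
    simp only [Set.mem_inter_iff, Set.mem_iInter]
    exact isGramSchmidtTransform_iff (hr.mem_orthogonal p.2) p.1 i
  rw [hset]
  refine IsClosed.inter ?_ ?_
  · exact isClosed_iInter fun a => isClosed_iInter fun b => isClosed_iInter fun _ =>
      isClosed_eq (hc.matrix_elem a b) continuous_const
  · exact isClosed_iInter fun a => isClosed_iInter fun b => isClosed_iInter fun _ =>
      isClosed_le continuous_const (hc.matrix_elem a b)

/-- Functions invariant under the stabilizer vary continuously along Gram-Schmidt transforms. -/
theorem IsAdmissibleLength.eventually_abs_sub_lt [IsTopologicalGroup G] [CompactSpace G]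
    (hr : IsAdmissibleLength φ r) {X : Matrix (Fin d) (Fin n) ℝ} {i : Fin (r X) → Fin n}
    (hi : LinearIndependent ℝ (fun a => X.col (i a))) {g' : G}
    (h' : IsGramSchmidtTransform (φ g') X i) {F : G → ℝ} (hFc : Continuous F)
    (hF : ∀ s : G, s • X = X → ∀ x, F (s * x) = F x) {ε : ℝ} (hε : 0 < ε) :
    ∀ᶠ Y in 𝓝 X, ∀ g, IsGramSchmidtTransform (φ g) Y i → |F g - F g'| < ε := by
  -- No `g` in this compact set is a transform at `X`, by uniqueness modulo the stabilizer. By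
  -- closedness the same holds on a neighbourhood of each `(X, g)`, and compactness gives one
  -- neighbourhood of `X` for all `g`.
  have hK : IsCompact {g : G | ε ≤ |F g - F g'|} :=
    (isClosed_le continuous_const (hFc.sub continuous_const).abs).isCompact
  have hev : ∀ g ∈ {g : G | ε ≤ |F g - F g'|}, ∀ᶠ z : Matrix (Fin d) (Fin n) ℝ × G in 𝓝 (X, g),
      ¬ IsGramSchmidtTransform (φ z.2) z.1 i := by
    intro g hg
    refine (hr.isClosed_isGramSchmidtTransform i).isOpen_compl.mem_nhds fun hgs => ?_
    have heq : F g = F g' := hr.eq_of_invariant hi hgs h' hF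
    have hle : ε ≤ |F g - F g'| := hg
    rw [heq, sub_self, abs_zero] at hle
    exact absurd hle (not_le.mpr hε)
  filter_upwards [hK.eventually_forall_of_forall_eventually
    (P := fun Y g => ¬ IsGramSchmidtTransform (φ g) Y i) hev] with Y hY g hg
  by_contra hlt
  exact hY g (not_lt.mp hlt) hg

/-- The heart of continuity. Neither `γ` nor the length is continuous in `Y`; only the invariance of
`F` and the marginals of the weights make the sums converge. -/
theorem IsAdmissibleLength.tendsto_sum_totalWeight [IsTopologicalGroup G] [CompactSpace G]
    (hr : IsAdmissibleLength φ r)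
    {γ : (X : Matrix (Fin d) (Fin n) ℝ) → (Fin (r X) → Fin n) → G}
    (hγ : ∀ X i, IsGramSchmidtTransform (φ (γ X i)) X i) (X : Matrix (Fin d) (Fin n) ℝ)
    {F : G → ℝ} (hFc : Continuous F) (hF : ∀ s : G, s • X = X → ∀ x, F (s * x) = F x) {C : ℝ}
    (hC : ∀ x, |F x| ≤ C) :
    Tendsto (fun Y => ∑ i, totalWeight Y i * F (γ Y i)) (𝓝 X)
      (𝓝 (∑ i, totalWeight X i * F (γ X i))) := by
  classical
  rw [Metric.tendsto_nhds]
  intro ε hε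
  set c : (Fin (r X) → Fin n) → ℝ := fun j => F (γ X j) with hc
  -- Error allowed at each sequence: small at sequences independent at `X`, the trivial bound `2 *
  -- C` at the others. The latter carry no weight at `X`, so the weighted error is `ε / 4` at `X`
  -- and below `ε / 2` nearby.
  set b : (Fin (r X) → Fin n) → ℝ := fun j =>
    if LinearIndependent ℝ (fun a => X.col (j a)) then ε / 4 else 2 * C with hb
  have hT : ∀ f : (Fin (r X) → Fin n) → ℝ, Tendsto (fun Y => ∑ j, totalWeight Y j * f j) (𝓝 X)
      (𝓝 (∑ j, totalWeight X j * f j)) := fun f =>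
    tendsto_finsetSum _ fun j _ =>
      (continuousAt_totalWeight (hr.le_rank X) j).tendsto.mul_const (f j)
  have hbX : ∑ j, totalWeight X j * b j = ε / 4 := by
    have : ∀ j, totalWeight X j * b j = totalWeight X j * (ε / 4) := by
      intro j
      by_cases hj : LinearIndependent ℝ (fun a => X.col (j a))
      · simp only [hb, if_pos hj]
      · have : totalWeight X j = 0 := by
          by_contra h
          exact hj (linearIndependent_of_totalWeight_ne_zero h)
        rw [this, zero_mul, zero_mul]
    simp_rw [this]
    rw [← Finset.sum_mul, sum_totalWeight X (hr.le_rank X), one_mul]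
  have hTb := hT b
  rw [hbX] at hTb
  have hloc : ∀ j : Fin (r X) → Fin n, ∀ᶠ Y in 𝓝 X, ∀ g,
      IsGramSchmidtTransform (φ g) Y j → |F g - c j| ≤ b j := by
    intro j
    by_cases hj : LinearIndependent ℝ (fun a => X.col (j a))
    · filter_upwards [hr.eventually_abs_sub_lt hj (hγ X j) hFc hF
        (ε := ε / 4) (by positivity)] with Y hY g hg
      simp only [hb, if_pos hj]
      exact (hY g hg).le
    · refine Eventually.of_forall fun Y g _ => ?_
      simp only [hb, if_neg hj]
      have h1 := abs_sub (F g) (c j)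
      have h2 := hC g
      have h3 := hC (γ X j)
      linarith
  filter_upwards [hr.eventually_le X, eventually_all.mpr hloc, Metric.tendsto_nhds.mp (hT c) (ε / 2)
    (by positivity), hTb.eventually (gt_mem_nhds (show ε / 4 < ε / 2 by linarith))]
    with Y hY1 hY2 hY3 hY4
  have hmain : |∑ i, totalWeight Y i * F (γ Y i) - ∑ j, totalWeight Y j * c j| ≤
      ∑ j, totalWeight Y j * b j := by
    -- Both sums over sequences of length `r X` are lifted to length `r Y`, so that the comparison
    -- is term by term.
    rw [← sum_totalWeight_castLE Y hY1 (hr.le_rank Y) c,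
      ← sum_totalWeight_castLE Y hY1 (hr.le_rank Y) b, ← Finset.sum_sub_distrib]
    refine (Finset.abs_sum_le_sum_abs _ _).trans (Finset.sum_le_sum fun i _ => ?_)
    rw [← mul_sub, abs_mul, abs_of_nonneg (totalWeight_nonneg _ _)]
    exact mul_le_mul_of_nonneg_left
      (hY2 _ _ (IsGramSchmidtTransform.castLE (hr.mem_orthogonal _) (hγ Y i) hY1))
      (totalWeight_nonneg _ _)
  rw [Real.dist_eq] at hY3 ⊢
  have htri := abs_sub_le (∑ i, totalWeight Y i * F (γ Y i)) (∑ j, totalWeight Y j * c j)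
    (∑ i, totalWeight X i * F (γ X i))
  linarith

variable [IsTopologicalGroup G] [CompactSpace G] [ContinuousSMul G (Matrix (Fin d) (Fin n) ℝ)]
  [SecondCountableTopology G] [MeasurableSpace G] [BorelSpace G]

theorem IsAdmissibleLength.isWeaklyEquivariant (hr : IsAdmissibleLength φ r)
    {γ : (X : Matrix (Fin d) (Fin n) ℝ) → (Fin (r X) → Fin n) → G}
    (hγ : ∀ X i, IsGramSchmidtTransform (φ (γ X i)) X i)
    {μ : Matrix (Fin d) (Fin n) ℝ → ProbabilityMeasure G}
    (hμ : ∀ X, X ≠ 0 → (μ X : Measure G) =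
      ∑ i : Fin (r X) → Fin n, ENNReal.ofReal (totalWeight X i) • Measure.dirac (γ X i)) :
    IsWeaklyEquivariant μ := by
  intro X g
  by_cases hX : X = 0
  · have hfix : ∀ h : G, h • X = X := fun h => by rw [hr.smul_eq, hX, Matrix.mul_zero]
    rw [hfix g, stabilizerAverage_of_fixed hfix, stabilizerLaw_map_mul_left X (hfix g)]
  · have hgX : g • X ≠ 0 := by
      intro h
      apply hX
      rw [← inv_smul_smul g X, h, hr.smul_eq, Matrix.mul_zero]
    have hlint : ∀ (Y : Matrix (Fin d) (Fin n) ℝ), Y ≠ 0 → ∀ f : G → ℝ≥0∞, Measurable f →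
        ∫⁻ x, f x ∂(stabilizerAverage Y (μ Y) : Measure G) =
          ∑ i, ENNReal.ofReal (totalWeight Y i) * ∫⁻ x, f (x * γ Y i) ∂(stabilizerLaw Y) := by
      intro Y hY f hf
      rw [lintegral_stabilizerAverage Y _ hf, hμ Y hY, lintegral_finsetSum_measure]
      refine Finset.sum_congr rfl fun i _ => ?_
      rw [lintegral_smul_measure, lintegral_dirac', smul_eq_mul]
      exact Measurable.lintegral_prod_left' (f := fun p : G × G => f (p.1 * p.2))
        (hf.comp measurable_mul)
    refine Measure.ext_of_lintegral _ fun f hf => ?_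
    rw [lintegral_map hf (measurable_const_mul g), hlint _ hgX f hf,
      hlint X hX (fun x => f (g * x)) (hf.comp (measurable_const_mul g))]
    refine sum_eq_sum_of_length_eq (hr.length_smul g X) _ _ fun i => ?_
    rw [totalWeight_cast (hr.length_smul g X)]
    have hW : totalWeight (g • X) i = totalWeight X i :=
      hr.totalWeight_smul g X i
    rw [← hW]
    by_cases h0 : totalWeight (g • X) i = 0
    · rw [h0, ENNReal.ofReal_zero, zero_mul, zero_mul]
    · have hi := linearIndependent_of_totalWeight_ne_zero h0
      have h2 : IsGramSchmidtTransform
          (φ (g * γ X fun a => i (Fin.cast (hr.length_smul g X).symm a))) (g • X) i := by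
        have h3 := IsGramSchmidtTransform.castLE (hr.mem_orthogonal _)
          (hγ X fun a => i (Fin.cast (hr.length_smul g X).symm a)) (hr.length_smul g X).le
        exact hr.isGramSchmidtTransform_smul h3 g
      rw [← lintegral_stabilizerLaw_smul X g _ hf]
      congr 1
      -- The chosen transform at `g • X` and the translate by `g` of the one at `X` bring the same
      -- independent columns into triangular form.
      exact hr.eq_of_invariant hi (hγ _ i) h2
        (F := fun h => ∫⁻ x, f (x * h) ∂(stabilizerLaw (g • X)))
        fun s hs x => lintegral_stabilizerLaw_mul_stabilizer _ hs x hf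

theorem IsAdmissibleLength.isContinuousFrame (hr : IsAdmissibleLength φ r)
    {γ : (X : Matrix (Fin d) (Fin n) ℝ) → (Fin (r X) → Fin n) → G}
    (hγ : ∀ X i, IsGramSchmidtTransform (φ (γ X i)) X i)
    {μ : Matrix (Fin d) (Fin n) ℝ → ProbabilityMeasure G}
    (hμ : ∀ X, X ≠ 0 → (μ X : Measure G) =
      ∑ i : Fin (r X) → Fin n, ENNReal.ofReal (totalWeight X i) • Measure.dirac (γ X i)) :
    IsContinuousFrame μ := by
  intro X u hu
  by_cases hX : X = 0
  · have hfix : ∀ h : G, h • X = X := fun h => by rw [hr.smul_eq, hX, Matrix.mul_zero]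
    have hconst : ∀ τ τ' : ProbabilityMeasure G,
        stabilizerAverage X τ = stabilizerAverage X τ' := fun τ τ' =>
      Subtype.ext ((stabilizerAverage_of_fixed hfix τ).trans
        (stabilizerAverage_of_fixed hfix τ').symm)
    simp_rw [fun k => hconst (μ (u k)) (μ X)]
    exact tendsto_const_nhds
  · rw [ProbabilityMeasure.tendsto_iff_forall_integral_tendsto]
    intro f
    set F : G → ℝ := fun h => ∫ x, f (x * h) ∂(stabilizerLaw X) with hFdef
    have hFc : Continuous F := continuous_integral_stabilizerLaw X f
    have hFC : ∀ x, |F x| ≤ ‖f‖ := fun h => by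
      have := norm_integral_le_of_norm_le_const (μ := stabilizerLaw (G := G) X)
        (Eventually.of_forall fun x => f.norm_coe_le_norm (x * h))
      simpa using this
    have hint : ∀ Y : Matrix (Fin d) (Fin n) ℝ, Y ≠ 0 →
        ∫ x, f x ∂(stabilizerAverage X (μ Y) : Measure G) =
          ∑ i, totalWeight Y i * F (γ Y i) := by
      intro Y hY
      rw [integral_stabilizerAverage, hμ Y hY, integral_finsetSum_measure]
      · refine Finset.sum_congr rfl fun i _ => ?_
        rw [integral_smul_measure, integral_dirac' _ _ hFc.stronglyMeasurable,
          ENNReal.toReal_ofReal (totalWeight_nonneg _ _), smul_eq_mul]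
      · intro i _
        refine Integrable.smul_measure ?_ ENNReal.ofReal_ne_top
        exact Integrable.of_bound hFc.aestronglyMeasurable ‖f‖ (Eventually.of_forall hFC)
    rw [hint X hX]
    have hlim := (hr.tendsto_sum_totalWeight hγ X hFc
      (fun s hs x => integral_stabilizerLaw_mul_stabilizer X hs x f.continuous) hFC).comp hu
    refine hlim.congr' ?_
    filter_upwards [hu.eventually (isOpen_ne.mem_nhds hX)] with k hk
    exact (hint _ hk).symm

theorem IsAdmissibleLength.exists_robustFrame (hr : IsAdmissibleLength φ r)
    {γ : (X : Matrix (Fin d) (Fin n) ℝ) → (Fin (r X) → Fin n) → G}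
    (hγ : ∀ X i, IsGramSchmidtTransform (φ (γ X i)) X i) (ν : ProbabilityMeasure G) :
    ∃ μ : Matrix (Fin d) (Fin n) ℝ → ProbabilityMeasure G,
      (μ 0 = ν ∧ ∀ X, X ≠ 0 → (μ X : Measure G) =
        ∑ i : Fin (r X) → Fin n, ENNReal.ofReal (totalWeight X i) • Measure.dirac (γ X i)) ∧
      IsRobustFrame μ := by
  classical
  let μ : Matrix (Fin d) (Fin n) ℝ → ProbabilityMeasure G := fun X =>
    if X = 0 then ν else
      ⟨_, isProbabilityMeasure_sum_totalWeight_dirac X (hr.le_rank X) (γ X)⟩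
  have hμ : ∀ X, X ≠ 0 → (μ X : Measure G) =
      ∑ i : Fin (r X) → Fin n, ENNReal.ofReal (totalWeight X i) • Measure.dirac (γ X i) := by
    intro X hX
    exact congrArg (fun τ : ProbabilityMeasure G => (τ : Measure G)) (if_neg hX)
  exact ⟨μ, ⟨if_pos rfl, hμ⟩, hr.isWeaklyEquivariant hγ hμ, hr.isContinuousFrame hγ hμ⟩

end Robustness

/-! ### Counting atoms; point clouds in general position. -/

section Cardinality

variable {d n : ℕ}

theorem encard_setOf_injective (t n : ℕ) :
    {i : Fin t → Fin n | Function.Injective i}.encard = (n.descFactorial t : ℕ∞) := by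
  have h : {i : Fin t → Fin n | Function.Injective i}.encard = ENat.card (Fin t ↪ Fin n) :=
    ENat.card_congr (Equiv.subtypeInjectiveEquivEmbedding (Fin t) (Fin n))
  rw [h, ENat.card_eq_coe_fintype_card, Fintype.card_embedding_eq, Fintype.card_fin,
    Fintype.card_fin]

theorem descFactorial_le_descFactorial_of_le {n k m : ℕ} (hkm : k ≤ m) (hmn : m ≤ n) :
    n.descFactorial k ≤ n.descFactorial m := by
  induction m, hkm using Nat.le_induction with
  | base => exact le_rfl
  | succ m hkm ih =>
    rw [Nat.descFactorial_succ]
    exact (ih (by omega)).trans (Nat.le_mul_of_pos_left _ (by omega))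

theorem injective_of_linearIndependent_columns {X : Matrix (Fin d) (Fin n) ℝ} {t : ℕ}
    {i : Fin t → Fin n} (hi : LinearIndependent ℝ (fun a => X.col (i a))) :
    Function.Injective i := fun _ _ h => hi.injective (congrArg X.col h)

/-- The atoms of a Gram-Schmidt frame come from the independent sequences of columns. -/
theorem setOf_atoms_sum_dirac {G : Type*} [MeasurableSpace G] [MeasurableSingletonClass G]
    (X : Matrix (Fin d) (Fin n) ℝ) {t : ℕ} (γ : (Fin t → Fin n) → G) :
    {g | 0 < (∑ i : Fin t → Fin n,
        ENNReal.ofReal (totalWeight X i) • Measure.dirac (γ i)) {g}} =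
      γ '' {i | LinearIndependent ℝ fun a => X.col (i a)} := by
  ext g
  rw [Set.mem_ofPred_eq, Measure.finsetSum_apply, Finset.sum_pos_iff, Set.mem_image]
  refine exists_congr fun i => ?_
  rw [Set.mem_ofPred_eq, Measure.smul_apply, smul_eq_mul,
    Measure.dirac_apply' _ (measurableSet_singleton g)]
  constructor
  · rintro ⟨-, h⟩
    have h' := mul_ne_zero_iff.mp h.ne'
    refine ⟨linearIndependent_of_totalWeight_ne_zero fun h0 => h'.1 (by simp [h0]), ?_⟩
    by_contra hne
    exact h'.2 (by simp [hne])
  · rintro ⟨h, rfl⟩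
    refine ⟨Finset.mem_univ i, ?_⟩
    simpa using (totalWeight_nonneg X i).lt_of_ne' (totalWeight_ne_zero h)

theorem encard_setOf_linearIndependent_le (X : Matrix (Fin d) (Fin n) ℝ) (t : ℕ) :
    {i : Fin t → Fin n | LinearIndependent ℝ fun a => X.col (i a)}.encard ≤
      (n.descFactorial t : ℕ∞) := by
  rw [← encard_setOf_injective]
  exact Set.encard_le_encard fun i hi => injective_of_linearIndependent_columns hi

/-- An orthogonal matrix is determined by its determinant and the images of `d - 1` independent
columns under its Gram-Schmidt transform. -/
theorem IsGramSchmidtTransform.eq_of_det_eq {g g' : Matrix (Fin d) (Fin d) ℝ}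
    (hg : g ∈ Matrix.orthogonalGroup (Fin d) ℝ) (hg' : g' ∈ Matrix.orthogonalGroup (Fin d) ℝ)
    {X : Matrix (Fin d) (Fin n) ℝ} {r : ℕ} {i : Fin r → Fin n} (hr : d ≤ r + 1)
    (hi : LinearIndependent ℝ (fun a => X.col (i a)))
    (h : IsGramSchmidtTransform g X i) (h' : IsGramSchmidtTransform g' X i)
    (hdet : g.det = g'.det) : g = g' := by
  have hfix := IsGramSchmidtTransform.mul_transpose_fixes hg hg' hi h h'
  have hgt : g'.transpose ∈ Matrix.orthogonalGroup (Fin d) ℝ := by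
    rw [Matrix.mem_orthogonalGroup_iff, Matrix.transpose_transpose]
    exact transpose_mul_self_of_mem_orthogonal hg'
  have hone := eq_one_of_rotation_fixes (Matrix.mem_specialOrthogonalGroup_iff.mpr
    ⟨mul_mem hg hgt, by
      rw [Matrix.det_mul, hdet, ← Matrix.det_mul, mul_transpose_self_of_mem_orthogonal hg',
        Matrix.det_one]⟩) hr hi hfix
  calc g = g * g'.transpose * g' := by
        rw [Matrix.mul_assoc, transpose_mul_self_of_mem_orthogonal hg', Matrix.mul_one]
    _ = g' := by rw [hone, Matrix.one_mul]

/-- An atom is sent to the first `d - 1` indices of a sequence producing it, together with its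
determinant; these data determine it. -/
theorem encard_image_isGramSchmidtTransform_le {G : Type*} {ψ : G → Matrix (Fin d) (Fin d) ℝ}
    (hψ : Function.Injective ψ) (horth : ∀ g, ψ g ∈ Matrix.orthogonalGroup (Fin d) ℝ)
    {X : Matrix (Fin d) (Fin n) ℝ} {r : ℕ} (hr : d - 1 ≤ r) {γ : (Fin r → Fin n) → G}
    (hγ : ∀ i, IsGramSchmidtTransform (ψ (γ i)) X i) :
    (γ '' {i | LinearIndependent ℝ fun a => X.col (i a)}).encard ≤
      2 * (n.descFactorial (d - 1) : ℕ∞) := by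
  have hcard : ({i : Fin (d - 1) → Fin n | Function.Injective i} ×ˢ ({1, -1} : Set ℝ)).encard =
      2 * (n.descFactorial (d - 1) : ℕ∞) := by
    rw [Set.encard_prod, encard_setOf_injective, Set.encard_pair (by norm_num), mul_comm]
  rw [← hcard]
  have hex : ∀ g : γ '' {i | LinearIndependent ℝ fun a => X.col (i a)},
      ∃ i : Fin r → Fin n, (LinearIndependent ℝ fun a => X.col (i a)) ∧ γ i = g := fun g => g.2
  choose i hi hig using hex
  have hli : ∀ g, LinearIndependent ℝ fun a : Fin (d - 1) => X.col (i g (Fin.castLE hr a)) :=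
    fun g => (hi g).comp _ (Fin.castLE_injective hr)
  refine Function.Embedding.encard_le ⟨fun g =>
    ⟨(fun a => i g (Fin.castLE hr a), (ψ g).det), ?_, ?_⟩, ?_⟩
  · exact injective_of_linearIndependent_columns (hli g)
  · exact det_eq_one_or_neg_one_of_mem_orthogonal (horth _)
  · intro g g' hgg
    obtain ⟨h1, h2⟩ := Prod.ext_iff.mp (Subtype.ext_iff.mp hgg)
    have hgs : ∀ g : γ '' {i | LinearIndependent ℝ fun a => X.col (i a)},
        IsGramSchmidtTransform (ψ g) X fun a : Fin (d - 1) => i g (Fin.castLE hr a) := by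
      intro g
      have h := (hγ (i g)).castLE (horth _) hr
      rwa [hig g] at h
    have hg' := hgs g'
    have h1' : (fun a : Fin (d - 1) => i g (Fin.castLE hr a)) =
      fun a => i g' (Fin.castLE hr a) := h1
    rw [← h1'] at hg'
    exact Subtype.ext (hψ (IsGramSchmidtTransform.eq_of_det_eq (horth _) (horth _) (by omega)
      (hli g) (hgs g) hg' h2))

/-- Any `d` or fewer different columns are linearly independent. -/
def IsGeneralPosition (X : Matrix (Fin d) (Fin n) ℝ) : Prop :=
  ∀ t ≤ d, ∀ i : Fin t → Fin n, Function.Injective i →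
    LinearIndependent ℝ fun a => X.col (i a)

theorem IsGeneralPosition.setOf_linearIndependent {X : Matrix (Fin d) (Fin n) ℝ}
    (hX : IsGeneralPosition X) {t : ℕ} (ht : t ≤ d) :
    {i : Fin t → Fin n | LinearIndependent ℝ fun a => X.col (i a)} =
      {i | Function.Injective i} :=
  Set.ext fun i => ⟨fun hi => injective_of_linearIndependent_columns hi, fun hi => hX t ht i hi⟩

theorem injective_snoc {t : ℕ} {i : Fin t → Fin n} (hi : Function.Injective i) {k : Fin n}
    (hk : ∀ a, i a ≠ k) : Function.Injective (Fin.snoc i k : Fin (t + 1) → Fin n) :=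
  Fin.snoc_injective_iff.mpr ⟨hi, fun ⟨a, ha⟩ => hk a ha⟩

/-- In general position, fewer than `d` columns can be read off a Gram-Schmidt transform. -/
theorem IsGeneralPosition.eq_of_isGramSchmidtTransform {X : Matrix (Fin d) (Fin n) ℝ}
    (hX : IsGeneralPosition X) {g : Matrix (Fin d) (Fin d) ℝ}
    (hg : g ∈ Matrix.orthogonalGroup (Fin d) ℝ) {r : ℕ} (hr : r < d) {i i' : Fin r → Fin n}
    (hi : Function.Injective i) (hi' : Function.Injective i')
    (h : IsGramSchmidtTransform g X i) (h' : IsGramSchmidtTransform g X i') : i = i' := by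
  rw [isGramSchmidtTransform_iff hg] at h h'
  have key : ∀ m : ℕ, ∀ hm : m < r, i ⟨m, hm⟩ = i' ⟨m, hm⟩ := by
    intro m
    induction m using Nat.strong_induction_on with
    | _ m ih =>
      intro hm
      by_contra hne
      have hinj : Function.Injective fun a : Fin (m + 1) => i (Fin.castLE hm a) :=
        hi.comp (Fin.castLE_injective _)
      have hk : Function.Injective (Fin.snoc (fun a : Fin (m + 1) => i (Fin.castLE hm a))
          (i' ⟨m, hm⟩) : Fin (m + 2) → Fin n) := by
        refine injective_snoc hinj fun a => ?_
        rcases Nat.lt_succ_iff_lt_or_eq.mp a.isLt with ha | ha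
        · have : i (Fin.castLE hm a) = i' (Fin.castLE hm a) := ih a ha _
          rw [this]
          intro heq
          have := congrArg Fin.val (hi' heq)
          simp at this
          omega
        · have : Fin.castLE hm a = ⟨m, hm⟩ := Fin.ext ha
          rw [this]
          exact hne
      -- At the first disagreement `m`, the columns `i 0, …, i m` and `i' m` are `m + 2 ≤ r + 1 ≤ d`
      -- in number, hence independent. But `g⁻¹` maps all of them into the span of the first `m + 1`
      -- coordinate vectors.
      have hli := hX (m + 2) (by omega) _ hk
      set k := (Fin.snoc (fun a : Fin (m + 1) => i (Fin.castLE hm a))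
          (i' ⟨m, hm⟩) : Fin (m + 2) → Fin n) with hkdef
      have hcast : ∀ (a : Fin d) (b : Fin (m + 1)),
          (g.transpose * X.submatrix id k) a b.castSucc =
            (g.transpose * X.submatrix id i) a (Fin.castLE hm b) := by
        intro a b
        simp [Matrix.mul_apply, hkdef]
      have hlast : ∀ a : Fin d, (g.transpose * X.submatrix id k) a (Fin.last (m + 1)) =
          (g.transpose * X.submatrix id i') a ⟨m, hm⟩ := by
        intro a
        simp [Matrix.mul_apply, hkdef]
      have hup : ∀ (a : Fin d) (b : Fin (m + 2)), (b : ℕ) < a →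
          (g.transpose * X.submatrix id k) a b = 0 := by
        intro a b
        refine Fin.lastCases (fun hab => ?_) (fun b hab => ?_) b
        · rw [hlast]
          rw [Fin.val_last] at hab
          exact h'.1 _ _ (by simp only; omega)
        · rw [hcast]
          exact h.1 _ _ hab
      have hli' : LinearIndependent ℝ (g.transpose * X.submatrix id k).col :=
        linearIndependent_orthogonal_transpose_mul hg hli
      refine diag_ne_zero_of_linearIndependent_col (r := m + 2) (by omega) hup hli'
        (Fin.last (m + 1)) ?_
      rw [hlast]
      exact h'.1 _ _ (by simp)
  funext a
  exact key a a.isLt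

theorem IsGeneralPosition.encard_image {X : Matrix (Fin d) (Fin n) ℝ}
    (hX : IsGeneralPosition X) {G : Type*} {ψ : G → Matrix (Fin d) (Fin d) ℝ}
    (horth : ∀ g, ψ g ∈ Matrix.orthogonalGroup (Fin d) ℝ) {r : ℕ} (hr : r < d)
    {γ : (Fin r → Fin n) → G} (hγ : ∀ i, IsGramSchmidtTransform (ψ (γ i)) X i) :
    (γ '' {i | LinearIndependent ℝ fun a => X.col (i a)}).encard =
      (n.descFactorial r : ℕ∞) := by
  rw [hX.setOf_linearIndependent hr.le, Set.InjOn.encard_image, encard_setOf_injective]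
  intro i hi i' hi' hii
  have h := hγ i'
  rw [← hii] at h
  exact hX.eq_of_isGramSchmidtTransform (horth _) hr hi hi' (hγ i) h

/-- The product is the determinant of the triangular form. So `det g` is the orientation of the `d`
columns when these are independent. -/
theorem isGramSchmidtTransform_det_mul_det_nonneg {g : Matrix (Fin d) (Fin d) ℝ}
    (hg : g ∈ Matrix.orthogonalGroup (Fin d) ℝ) {X : Matrix (Fin d) (Fin n) ℝ}
    {i : Fin d → Fin n} (h : IsGramSchmidtTransform g X i) :
    0 ≤ g.det * (X.submatrix id i).det := by
  rw [isGramSchmidtTransform_iff hg] at h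
  rw [← Matrix.det_transpose g, ← Matrix.det_mul,
    Matrix.det_of_isUpperTriangular (fun a b hab => h.1 a b hab)]
  exact Finset.prod_nonneg fun a _ => h.2 a a rfl

/-- If the columns sum to zero, then every sequence of `d - 1` columns can be completed to a basis
of either orientation. -/
theorem IsGeneralPosition.exists_snoc_det {m : ℕ} {X : Matrix (Fin (m + 1)) (Fin n) ℝ}
    (hX : IsGeneralPosition X) (hsum : ∑ k, X.col k = 0) (hn : m + 1 < n)
    {j : Fin m → Fin n} (hj : Function.Injective j) {s : ℝ} (hs : s ≠ 0) :
    ∃ k, 0 < s * (X.submatrix id (Fin.snoc j k : Fin (m + 1) → Fin n)).det := by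
  obtain ⟨k₀, hk₀⟩ : ∃ k₀, ∀ a, j a ≠ k₀ := by
    by_contra! h
    have := Fintype.card_le_of_surjective j h
    simp only [Fintype.card_fin] at this
    omega
  set M := X.submatrix id (Fin.snoc j k₀ : Fin (m + 1) → Fin n) with hM
  have hupd : ∀ k, X.submatrix id (Fin.snoc j k : Fin (m + 1) → Fin n) =
      M.updateCol (Fin.last m) (X.col k) := by
    intro k
    ext a b
    refine Fin.lastCases ?_ (fun b => ?_) b
    · simp
    · rw [Matrix.updateCol_ne (Fin.castSucc_lt_last b).ne]
      simp [hM]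
  -- The determinant is linear in its last column, so the sum over `k` is a determinant with last
  -- column `∑ k, X.col k = 0`. One term is nonzero, so some term is positive.
  have hzero : ∑ k, s * (X.submatrix id (Fin.snoc j k : Fin (m + 1) → Fin n)).det = 0 := by
    rw [← Finset.mul_sum]
    simp_rw [hupd, ← Matrix.cramer_apply]
    rw [← Finset.sum_apply, ← map_sum, hsum, map_zero, Pi.zero_apply, mul_zero]
  have hne : s * M.det ≠ 0 := by
    refine mul_ne_zero hs fun h0 => ?_
    obtain ⟨v, hv, hMv⟩ := Matrix.exists_mulVec_eq_zero_iff.mpr h0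
    have hli := hX (m + 1) le_rfl _ (injective_snoc hj hk₀)
    rw [← col_submatrix_id, ← Matrix.mulVec_injective_iff] at hli
    exact hv (hli (hMv.trans (Matrix.mulVec_zero _).symm))
  obtain ⟨k, -, hk⟩ := Finset.exists_pos_of_sum_zero_of_exists_nonzero _ hzero
    ⟨k₀, Finset.mem_univ _, hne⟩
  exact ⟨k, hk⟩

/-- Each pair of an injective sequence of length `d - 1` and a sign gives an atom: append a column
with that orientation. The sign is recovered as the determinant of the atom, the sequence by general
position. -/
theorem IsGeneralPosition.le_encard_image {X : Matrix (Fin d) (Fin n) ℝ}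
    (hX : IsGeneralPosition X) (hsum : ∑ k, X.col k = 0) (hd : 1 ≤ d) (hn : d < n)
    {G : Type*} {ψ : G → Matrix (Fin d) (Fin d) ℝ}
    (horth : ∀ g, ψ g ∈ Matrix.orthogonalGroup (Fin d) ℝ) {r : ℕ} (hr : r = d)
    {γ : (Fin r → Fin n) → G} (hγ : ∀ i, IsGramSchmidtTransform (ψ (γ i)) X i) :
    2 * (n.descFactorial (d - 1) : ℕ∞) ≤
      (γ '' {i | LinearIndependent ℝ fun a => X.col (i a)}).encard := by
  subst hr
  obtain ⟨m, rfl⟩ : ∃ m, r = m + 1 := ⟨r - 1, by omega⟩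
  rw [Nat.add_sub_cancel]
  have hcard : ({j : Fin m → Fin n | Function.Injective j} ×ˢ ({1, -1} : Set ℝ)).encard =
      2 * (n.descFactorial m : ℕ∞) := by
    rw [Set.encard_prod, encard_setOf_injective, Set.encard_pair (by norm_num), mul_comm]
  rw [← hcard]
  have hex : ∀ p : ({j : Fin m → Fin n | Function.Injective j} ×ˢ ({1, -1} : Set ℝ) :
      Set ((Fin m → Fin n) × ℝ)),
      ∃ k, 0 < p.1.2 * (X.submatrix id (Fin.snoc p.1.1 k : Fin (m + 1) → Fin n)).det := by
    intro p
    refine hX.exists_snoc_det hsum hn p.2.1 ?_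
    rcases p.2.2 with h | h
    · rw [h]; norm_num
    · rw [h]; norm_num
  choose k hk using hex
  have hdet : ∀ p, (ψ (γ (Fin.snoc p.1.1 (k p)))).det = p.1.2 := by
    intro p
    have h1 := isGramSchmidtTransform_det_mul_det_nonneg (horth _)
      (hγ (Fin.snoc p.1.1 (k p)))
    have h2 := hk p
    rcases det_eq_one_or_neg_one_of_mem_orthogonal (horth (γ (Fin.snoc p.1.1 (k p)))) with h3 | h3 <;>
    rcases p.2.2 with h4 | h4 <;> rw [h3] at h1 ⊢ <;> rw [h4] at h2 ⊢ <;> linarith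
  have hrestr : ∀ p, IsGramSchmidtTransform (ψ (γ (Fin.snoc p.1.1 (k p)))) X p.1.1 := by
    intro p
    have h := (hγ (Fin.snoc p.1.1 (k p))).castLE (horth _) (Nat.le_succ m)
    have heq : (fun a : Fin m => (Fin.snoc p.1.1 (k p) : Fin (m + 1) → Fin n)
        (Fin.castLE (Nat.le_succ m) a)) = p.1.1 := by
      funext a
      exact Fin.snoc_castSucc (α := fun _ => Fin n) _ _ a
    rwa [heq] at h
  refine Function.Embedding.encard_le
    ⟨fun p => ⟨γ (Fin.snoc p.1.1 (k p)), _, ?_, rfl⟩, fun p p' hpp => ?_⟩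
  · have h := hk p
    rw [Set.mem_ofPred_eq, ← columnGram_det_ne_zero_iff, columnGram_eq_transpose_mul,
      Matrix.det_mul, Matrix.det_transpose]
    have h0 := (mul_ne_zero_iff.mp h.ne').2
    exact mul_ne_zero h0 h0
  · have hpp' : γ (Fin.snoc p.1.1 (k p)) = γ (Fin.snoc p'.1.1 (k p')) := Subtype.ext_iff.mp hpp
    refine Subtype.ext (Prod.ext ?_ ?_)
    · have h := hrestr p'
      rw [← hpp'] at h
      exact hX.eq_of_isGramSchmidtTransform (horth _) (Nat.lt_succ_self m) p.2.1 p'.2.1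
        (hrestr p) h
    · rw [← hdet p, ← hdet p', hpp']

/-- A rescaled moment curve whose points sum to zero if there are more than `d` of them. -/
noncomputable def alternatingMomentCurve (d n : ℕ) : Matrix (Fin d) (Fin n) ℝ :=
  Matrix.of fun a k =>
    (((-1 : ℤ) ^ (n - 1 - k) * ((n - 1).choose k : ℤ) : ℤ) : ℝ) * (k : ℝ) ^ (a : ℕ)

/-- Vandermonde: the nodes are distinct, and the rescaling factors are nonzero because `k ≤ n - 1`.
-/
theorem isGeneralPosition_alternatingMomentCurve (d n : ℕ) :
    IsGeneralPosition (alternatingMomentCurve d n) := by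
  intro t ht i hi
  rw [Fintype.linearIndependent_iff]
  intro v hv b
  have hc : ∀ k : Fin n, (((-1 : ℤ) ^ (n - 1 - k) * ((n - 1).choose k : ℤ) : ℤ) : ℝ) ≠ 0 := by
    intro k
    have : (n - 1).choose k ≠ 0 := (Nat.choose_pos (by omega)).ne'
    push_cast
    exact mul_ne_zero (pow_ne_zero _ (by norm_num)) (by exact_mod_cast this)
  have hinj : Function.Injective fun b : Fin t => ((i b : ℕ) : ℝ) := fun b b' h =>
    hi (Fin.ext (Nat.cast_injective h))
  have hz := Matrix.eq_zero_of_forall_pow_sum_mul_pow_eq_zero hinj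
    (v := fun b => v b * (((-1 : ℤ) ^ (n - 1 - (i b : ℕ)) *
      ((n - 1).choose (i b) : ℤ) : ℤ) : ℝ)) (fun a => by
      have h := congrFun hv (Fin.castLE ht a)
      simp only [Finset.sum_apply, Pi.smul_apply, smul_eq_mul, Pi.zero_apply] at h
      rw [← h]
      refine Finset.sum_congr rfl fun b _ => ?_
      rw [mul_assoc]
      rfl)
  exact (mul_eq_zero.mp (congrFun hz b)).resolve_right (hc _)

/-- Coordinate `a` of the sum is the `(n - 1)`-st finite difference of `x ^ a` at `0`, which
vanishes since `a < d ≤ n - 1`. -/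
theorem sum_col_alternatingMomentCurve {d n : ℕ} (hn : d < n) :
    ∑ k, (alternatingMomentCurve d n).col k = 0 := by
  funext a
  have h := congrFun (fwdDiff_iter_pow_eq_zero_of_lt (R := ℝ) (j := a) (n := n - 1) (by omega)) 0
  rw [fwdDiff_iter_eq_sum_shift, Nat.sub_add_cancel (by omega), Finset.sum_range] at h
  rw [Finset.sum_apply]
  refine Eq.trans (Finset.sum_congr rfl fun k _ => ?_) h
  simp [alternatingMomentCurve, Matrix.col, zsmul_eq_mul]

theorem min_le_rank_alternatingMomentCurve (d n : ℕ) :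
    min d n ≤ (alternatingMomentCurve d n).rank :=
  le_rank_of_linearIndependent_columns (isGeneralPosition_alternatingMomentCurve d n _
    (min_le_left _ _) (Fin.castLE (min_le_right _ _)) (Fin.castLE_injective _))

end Cardinality

/-! ### The two groups and their cardinalities. -/

section Main

variable {d n : ℕ}

theorem rank_orthogonal_mul {g : Matrix (Fin d) (Fin d) ℝ}
    (hg : g ∈ Matrix.orthogonalGroup (Fin d) ℝ) (X : Matrix (Fin d) (Fin n) ℝ) :
    (g * X).rank = X.rank := by
  refine Matrix.rank_mul_eq_right_of_det_ne_zero g X ?_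
  rcases det_eq_one_or_neg_one_of_mem_orthogonal hg with h | h <;> rw [h] <;> norm_num

theorem orthogonalGroup_of_rotation (g : SOGroup d) :
    (g : Matrix (Fin d) (Fin d) ℝ) ∈ Matrix.orthogonalGroup (Fin d) ℝ :=
  (Matrix.mem_specialOrthogonalGroup_iff.mp g.2).1

theorem isAdmissibleLength_rotation (d n : ℕ) :
    IsAdmissibleLength (G := SOGroup d) (Matrix.specialOrthogonalGroup (Fin d) ℝ).subtype
      (rotationLength : Matrix (Fin d) (Fin n) ℝ → ℕ) where
  continuous := continuous_subtype_val
  mem_orthogonal := orthogonalGroup_of_rotation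
  smul_eq _ _ := rfl
  le_rank _ := min_le_left _ _
  length_smul g X :=
    congrArg (min · (d - 1)) (rank_orthogonal_mul (orthogonalGroup_of_rotation g) X)
  eventually_le X := by
    filter_upwards [eventually_rank_le X] with Y hY
    exact min_le_min_right _ hY
  fixes X i hi g hfix := by
    -- Either the selected columns span the column space, or the length is `d - 1` and the rotation
    -- is trivial.
    by_cases h : X.rank ≤ rotationLength X
    · exact orthogonal_mul_eq_of_fixes h hi hfix
    · have hr : d ≤ rotationLength X + 1 := by
        simp only [rotationLength] at h ⊢
        omega
      have hone := eq_one_of_rotation_fixes g.2 hr hi hfix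
      rw [Submonoid.coe_subtype, hone, Matrix.one_mul]

theorem isAdmissibleLength_orthogonal (d n : ℕ) :
    IsAdmissibleLength (G := OGroup d) (Matrix.orthogonalGroup (Fin d) ℝ).subtype
      (orthogonalLength : Matrix (Fin d) (Fin n) ℝ → ℕ) where
  continuous := continuous_subtype_val
  mem_orthogonal g := g.2
  smul_eq _ _ := rfl
  le_rank _ := le_rfl
  length_smul g X := rank_orthogonal_mul g.2 X
  eventually_le X := eventually_rank_le X
  fixes _ _ hi _ hfix := orthogonal_mul_eq_of_fixes le_rfl hi hfix

theorem exists_isGramSchmidtChoice_rotation (hd : 1 ≤ d) :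
    ∃ γ : (X : Matrix (Fin d) (Fin n) ℝ) → (Fin (rotationLength X) → Fin n) → SOGroup d,
      IsGramSchmidtChoice (Matrix.specialOrthogonalGroup (Fin d) ℝ) rotationLength γ := by
  have h : ∀ (X : Matrix (Fin d) (Fin n) ℝ) (i : Fin (rotationLength X) → Fin n),
      ∃ g : SOGroup d, IsGramSchmidtTransform (g : Matrix (Fin d) (Fin d) ℝ) X i := by
    intro X i
    obtain ⟨g, hg, hgs⟩ := exists_rotation_isGramSchmidtTransform X
      (show rotationLength X < d by simp only [rotationLength]; omega) i
    exact ⟨⟨g, hg⟩, hgs⟩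
  choose γ hγ using h
  exact ⟨γ, hγ⟩

theorem exists_isGramSchmidtChoice_orthogonal :
    ∃ γ : (X : Matrix (Fin d) (Fin n) ℝ) → (Fin (orthogonalLength X) → Fin n) → OGroup d,
      IsGramSchmidtChoice (Matrix.orthogonalGroup (Fin d) ℝ) orthogonalLength γ := by
  have h : ∀ (X : Matrix (Fin d) (Fin n) ℝ) (i : Fin (orthogonalLength X) → Fin n),
      ∃ g : OGroup d, IsGramSchmidtTransform (g : Matrix (Fin d) (Fin d) ℝ) X i := by
    intro X i
    obtain ⟨g, hg, hgs⟩ := exists_orthogonal_isGramSchmidtTransform X X.rank_le_height i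
    exact ⟨⟨g, hg⟩, hgs⟩
  choose γ hγ using h
  exact ⟨γ, hγ⟩

theorem atomCount_eq_encard {S : Submonoid (Matrix (Fin d) (Fin d) ℝ)}
    {r : Matrix (Fin d) (Fin n) ℝ → ℕ}
    {γ : (X : Matrix (Fin d) (Fin n) ℝ) → (Fin (r X) → Fin n) → S}
    {ν : ProbabilityMeasure S} {μ : Matrix (Fin d) (Fin n) ℝ → ProbabilityMeasure S}
    (hμ : IsGramSchmidtFrame S r γ ν μ) {X : Matrix (Fin d) (Fin n) ℝ} (hX : X ≠ 0) :
    atomCount (μ X) = (γ X '' {i | LinearIndependent ℝ fun a => X.col (i a)}).encard := by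
  rw [atomCount, hμ.2 X hX, setOf_atoms_sum_dirac]

theorem frameCardinality_le {S : Submonoid (Matrix (Fin d) (Fin d) ℝ)}
    {r : Matrix (Fin d) (Fin n) ℝ → ℕ}
    {γ : (X : Matrix (Fin d) (Fin n) ℝ) → (Fin (r X) → Fin n) → S}
    {ν : ProbabilityMeasure S} {μ : Matrix (Fin d) (Fin n) ℝ → ProbabilityMeasure S}
    (hμ : IsGramSchmidtFrame S r γ ν μ) {N : ℕ∞} (hν : atomCount ν ≤ N)
    (h : ∀ X, (γ X '' {i | LinearIndependent ℝ fun a => X.col (i a)}).encard ≤ N) :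
    frameCardinality μ ≤ N := by
  refine iSup_le fun X => ?_
  by_cases hX : X = 0
  · rw [hX, hμ.1]
    exact hν
  · rw [atomCount_eq_encard hμ hX]
    exact h X

theorem ne_zero_of_rank_pos {X : Matrix (Fin d) (Fin n) ℝ} (h : 0 < X.rank) : X ≠ 0 := by
  rintro rfl
  simp at h

theorem one_le_atomCount_of_subsingleton {G : Type*} [MeasurableSpace G] [Subsingleton G]
    [One G] (τ : ProbabilityMeasure G) : 1 ≤ atomCount τ := by
  rw [atomCount, Set.one_le_encard_iff_nonempty]
  refine ⟨1, ?_⟩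
  have h : ({1} : Set G) = Set.univ := Set.subsingleton_univ.eq_singleton_of_mem trivial |>.symm
  rw [Set.mem_ofPred_eq, h, measure_univ]
  exact one_pos

theorem subsingleton_rotation_one : Subsingleton (SOGroup 1) := by
  refine ⟨fun g h => ?_⟩
  have hone : ∀ g : SOGroup 1, g = 1 := fun g =>
    Subtype.ext (eq_one_of_rotation_fixes (n := 0) g.2 (X := 0) (r := 0) le_rfl (i := Fin.elim0)
      linearIndependent_empty_type (by ext a b; exact b.elim0))
  rw [hone g, hone h]

theorem frameCardinality_rotation (hd : 1 ≤ d)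
    {γ : (X : Matrix (Fin d) (Fin n) ℝ) → (Fin (rotationLength X) → Fin n) → SOGroup d}
    (hγ : IsGramSchmidtChoice (Matrix.specialOrthogonalGroup (Fin d) ℝ) rotationLength γ)
    {ν : ProbabilityMeasure (SOGroup d)}
    {μ : Matrix (Fin d) (Fin n) ℝ → ProbabilityMeasure (SOGroup d)}
    (hμ : IsGramSchmidtFrame (Matrix.specialOrthogonalGroup (Fin d) ℝ) rotationLength γ ν μ)
    (hn : d - 1 ≤ n) (hν : atomCount ν ≤ (n.descFactorial (d - 1) : ℕ∞)) :
    frameCardinality μ = (n.descFactorial (d - 1) : ℕ∞) := by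
  refine le_antisymm (frameCardinality_le hμ hν fun X => ?_) ?_
  · refine (Set.encard_image_le _ _).trans ((encard_setOf_linearIndependent_le X _).trans ?_)
    exact_mod_cast descFactorial_le_descFactorial_of_le (min_le_right _ _) hn
  -- For `d = 1` there may be no nonzero `X` (if `n = 0`), but `SO(1)` is trivial, so the measure at
  -- the origin already has one atom. For `d ≥ 2` the moment curve is nonzero, because its rank is
  -- at least `d - 1`.
  · rcases Nat.eq_or_lt_of_le hd with rfl | hd2
    · have := subsingleton_rotation_one
      rw [Nat.sub_self, Nat.descFactorial_zero, Nat.cast_one]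
      exact (one_le_atomCount_of_subsingleton (μ 0)).trans (le_iSup (fun X => atomCount (μ X)) 0)
    · have hrank := min_le_rank_alternatingMomentCurve d n
      have hlen : rotationLength (alternatingMomentCurve d n) = d - 1 := by
        simp only [rotationLength]
        omega
      have hgp := isGeneralPosition_alternatingMomentCurve d n
      have hcard := hgp.encard_image (ψ := ((↑) : SOGroup d → Matrix (Fin d) (Fin d) ℝ))
        orthogonalGroup_of_rotation (by omega) (hγ (alternatingMomentCurve d n))
      rw [← hlen, ← hcard, ← atomCount_eq_encard hμ (ne_zero_of_rank_pos (by omega))]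
      exact le_iSup (fun X => atomCount (μ X)) _

theorem frameCardinality_orthogonal_le
    {γ : (X : Matrix (Fin d) (Fin n) ℝ) → (Fin (orthogonalLength X) → Fin n) → OGroup d}
    (hγ : IsGramSchmidtChoice (Matrix.orthogonalGroup (Fin d) ℝ) orthogonalLength γ)
    {ν : ProbabilityMeasure (OGroup d)}
    {μ : Matrix (Fin d) (Fin n) ℝ → ProbabilityMeasure (OGroup d)}
    (hμ : IsGramSchmidtFrame (Matrix.orthogonalGroup (Fin d) ℝ) orthogonalLength γ ν μ)
    (hn : d - 1 ≤ n) (hν : atomCount ν ≤ (2 * n.descFactorial (d - 1) : ℕ∞)) :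
    frameCardinality μ ≤ (2 * n.descFactorial (d - 1) : ℕ∞) := by
  refine frameCardinality_le hμ hν fun X => ?_
  rcases le_total (d - 1) (orthogonalLength X) with h | h
  · exact encard_image_isGramSchmidtTransform_le Subtype.val_injective (fun g => g.2) h (hγ X)
  · refine (Set.encard_image_le _ _).trans ((encard_setOf_linearIndependent_le X _).trans ?_)
    have := descFactorial_le_descFactorial_of_le h hn
    exact_mod_cast this.trans (Nat.le_mul_of_pos_left _ two_pos)

theorem le_frameCardinality_orthogonal (hd : 1 ≤ d)
    {γ : (X : Matrix (Fin d) (Fin n) ℝ) → (Fin (orthogonalLength X) → Fin n) → OGroup d}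
    (hγ : IsGramSchmidtChoice (Matrix.orthogonalGroup (Fin d) ℝ) orthogonalLength γ)
    {ν : ProbabilityMeasure (OGroup d)}
    {μ : Matrix (Fin d) (Fin n) ℝ → ProbabilityMeasure (OGroup d)}
    (hμ : IsGramSchmidtFrame (Matrix.orthogonalGroup (Fin d) ℝ) orthogonalLength γ ν μ)
    (hn : d + 1 ≤ n) : (2 * n.descFactorial (d - 1) : ℕ∞) ≤ frameCardinality μ := by
  have hrank := min_le_rank_alternatingMomentCurve d n
  have hlen : orthogonalLength (alternatingMomentCurve d n) = d :=
    le_antisymm (Matrix.rank_le_height _) (by simp only [orthogonalLength]; omega)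
  refine ((isGeneralPosition_alternatingMomentCurve d n).le_encard_image
    (sum_col_alternatingMomentCurve hn) hd hn (fun g : OGroup d => g.2) hlen
    (hγ (alternatingMomentCurve d n))).trans ?_
  rw [← atomCount_eq_encard hμ (ne_zero_of_rank_pos (by omega))]
  exact le_iSup (fun X => atomCount (μ X)) _

end Main

theorem mainTheorem9 (d n : ℕ) (hd : 1 ≤ d) :
    -- the frame for `SO(d)`
    ((∃ γ : (X : Matrix (Fin d) (Fin n) ℝ) → (Fin (rotationLength X) → Fin n) → SOGroup d,
        IsGramSchmidtChoice (Matrix.specialOrthogonalGroup (Fin d) ℝ) rotationLength γ) ∧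
      ∀ γ : (X : Matrix (Fin d) (Fin n) ℝ) → (Fin (rotationLength X) → Fin n) → SOGroup d,
        IsGramSchmidtChoice (Matrix.specialOrthogonalGroup (Fin d) ℝ) rotationLength γ →
        ∀ ν : ProbabilityMeasure (SOGroup d),
          ∃ μ : Matrix (Fin d) (Fin n) ℝ → ProbabilityMeasure (SOGroup d),
            IsGramSchmidtFrame (Matrix.specialOrthogonalGroup (Fin d) ℝ) rotationLength γ ν μ ∧
            IsRobustFrame μ ∧
            (d - 1 ≤ n → atomCount ν ≤ (n.descFactorial (d - 1) : ℕ∞) →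
              frameCardinality μ = (n.descFactorial (d - 1) : ℕ∞))) ∧
    -- the frame for `O(d)`
    ((∃ γ : (X : Matrix (Fin d) (Fin n) ℝ) → (Fin (orthogonalLength X) → Fin n) → OGroup d,
        IsGramSchmidtChoice (Matrix.orthogonalGroup (Fin d) ℝ) orthogonalLength γ) ∧
      ∀ γ : (X : Matrix (Fin d) (Fin n) ℝ) → (Fin (orthogonalLength X) → Fin n) → OGroup d,
        IsGramSchmidtChoice (Matrix.orthogonalGroup (Fin d) ℝ) orthogonalLength γ →
        ∀ ν : ProbabilityMeasure (OGroup d),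
          ∃ μ : Matrix (Fin d) (Fin n) ℝ → ProbabilityMeasure (OGroup d),
            IsGramSchmidtFrame (Matrix.orthogonalGroup (Fin d) ℝ) orthogonalLength γ ν μ ∧
            IsRobustFrame μ ∧
            (d - 1 ≤ n → atomCount ν ≤ (2 * n.descFactorial (d - 1) : ℕ∞) →
              frameCardinality μ ≤ (2 * n.descFactorial (d - 1) : ℕ∞) ∧
              (d + 1 ≤ n → frameCardinality μ = (2 * n.descFactorial (d - 1) : ℕ∞)))) := by
  refine ⟨⟨exists_isGramSchmidtChoice_rotation hd, fun γ hγ ν => ?_⟩,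
    ⟨exists_isGramSchmidtChoice_orthogonal, fun γ hγ ν => ?_⟩⟩
  · obtain ⟨μ, hμ, hrob⟩ := (isAdmissibleLength_rotation d n).exists_robustFrame hγ ν
    exact ⟨μ, hμ, hrob, fun hn hν => frameCardinality_rotation hd hγ hμ hn hν⟩
  · obtain ⟨μ, hμ, hrob⟩ := (isAdmissibleLength_orthogonal d n).exists_robustFrame hγ ν
    exact ⟨μ, hμ, hrob, fun hn hν =>
      ⟨frameCardinality_orthogonal_le hγ hμ hn hν, fun hn' =>
        le_antisymm (frameCardinality_orthogonal_le hγ hμ hn hν)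
          (le_frameCardinality_orthogonal hd hγ hμ hn')⟩⟩
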